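/- Let $f_1,\dots,f_n$, $f_i:\mathbb R^{d_i}\to\mathbb R\cup\{+\infty\}$, be proper, lower semicontinuous, 1-coercive ($f_i(x)/\|x\|\to+\infty$ as $\|x\|\to\infty$) and minorized by an affine function, let $A=(A_1,\dots,A_n)$ with $A_i\in\mathbb R^{m\times d_i}$, and let $b\in\mathbb R^m$. Let $f_i^{**}$ be the biconjugate (convex envelope) of $f_i$, and for $u\in\mathbb R^m$ put $$h_P(u)=\inf\Big\{\sum_{i=1}^n f_i(x_i): Ax-b\le u\Big\},\qquad h_{CoP}(u)=\inf\Big\{\sum_{i=1}^n f_i^{**}(x_i): Ax-b\le u\Big\}.$$ Assume $h_{CoP}(0)<+\infty$. Let $$\rho_k(f_i)=\sup\Big\{f_i\Big(\sum_{j=1}^{d_i+1}\alpha_jx_j\Big)-\sum_{j=1}^{d_i+1}\alpha_jf_i(x_j):\ x_j\in\operatorname{dom} f_i,\ \alpha\ge0,\ \mathbf 1^\top\alpha=1,\ \operatorname{Card}(\alpha)\le k\Big\}$$ and $\mathcal F_i=\{(f_i^{**}(x),A_ix): x\in\operatorname{dom} f_i^{**}\}\subset\mathbb R^{m+1}$;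 call $(f_i^{**}(x),A_ix)$ with $f_i(x)=f_i^{**}(x)<+\infty$ a contact point of $\mathcal F_i$. Let $\mathcal G_r^{**}$ be the closed convex hull of $\{(r_0,r)\in\mathbb R^{1+m}:\ \exists x,\ \sum_if_i(x_i)\le r_0,\ Ax-b\le r\}$ and $\Psi(\lambda)=\inf\{r_0+\lambda^\top r:(r_0,r)\in\mathcal G_r^{**}\}$ the Lagrange dual function. Consider $x^\star\in\mathbb R^d$ feasible for $Ax\le b$ with $\sum_if_i^{**}(x_i^\star)=h_{CoP}(0)$, a vector $w\in\mathbb R^m_+$, weights $\lambda_{ij}\ge0$ with $\sum_{j=1}^{m+2}\lambda_{ij}=1$ for each $i$, at most $n+m+1$ of them nonzero, and contact points $z_{ij}$ of $\mathcal F_i$, such that $$z^\star=\sum_{i=1}^n\begin{pmatrix}f_i^{**}(x_i^\star)\\A_ix_i^\star\end{pmatrix}+\begin{pmatrix}0\\w-b\end{pmatrix}=\sum_{i=1}^n\sum_{j=1}^{m+2}\lambda_{ij}z_{ij}+\begin{pmatrix}0\\w-b\end{pmatrix}$$ lies in $\mathcal G_r^{**}$ and attains the infimum defining $\Psi(\lambda)$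 for every $\lambda\geq 0$ that maximizes $\Psi$ over $\mathbb R^m_+$. Put $$R_v=\max_{ij:\lambda_{ij}\ne1}\|\lambda_{ij}z_{ij}\|_2,\quad R_\lambda=\max_{ij:\lambda_{ij}\ne1}|\lambda_{ij}|,\quad M_V=\sup_{\|a\|_2\le1,\ v_i\in\mathcal F_i}\Big\|\sum_ia_iv_i\Big\|_2\in[0,+\infty]$$ (a maximum over the empty set is $0$, and $0\cdot\infty=0$). For $s\in\mathbb R$, an $s$-sparse error is a vector $u=(u_1,u_2)\in\mathbb R\times\mathbb R^m$ of the form $u=\sum_{i,j}\mu_{ij}y_{ij}+(0,w-b)-z^\star$ with contact points $y_{ij}$ of $\mathcal F_i$ ($1\le i\le n$, $1\le j\le m+2$), $\mu_{ij}\ge0$, $\sum_j\mu_{ij}=1$, and at most $s$ nonzero $\mu_{ij}$. **Claim.** There is an absolute constant $c>0$ such that for all data as above: such $x^\star,w,\lambda_{ij},z_{ij}$ exist; and for every such choice and every $\gamma>0$, with $$s=n+1+2m\,\frac{c}{\gamma^2+c},$$ there is an $s$-sparse error $u=(u_1,u_2)$ with $$h_{CoP}(u_2)\le h_P(u_2)\le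 h_{CoP}(0)+|u_1|+\max\Big\{\sum_{i=1}^n\rho_{\beta_i}(f_i):\ \beta_i\in\{1,\dots,m+2\},\ \sum_{i=1}^n\beta_i\le s\Big\}$$ and $$\max\{|u_1|,\|u_2\|_2\}\le\sqrt{2m}\,(R_v+R_\lambda M_V)\,\gamma .$$ Moreover these two bounds hold for every $s$-sparse error $u$ of minimal Euclidean norm. -/

import Mathlib

open scoped BigOperators

noncomputable section

/-- Euclidean space of dimension `d`. -/
abbrev Euc (d : ℕ) : Type := EuclideanSpace ℝ (Fin d)

/-- The space of pairs (objective value, constraint values), of dimension `m + 1`, with its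
Euclidean norm. -/
abbrev EpiSpace (m : ℕ) : Type := WithLp 2 (ℝ × EuclideanSpace ℝ (Fin m))

/-- The Fenchel conjugate of an extended-real-valued function. -/
def fenchelConj {d : ℕ} (f : Euc d → EReal) (y : Euc d) : EReal :=
  ⨆ x : Euc d, ((inner ℝ y x : ℝ) : EReal) - f x

/-- The biconjugate (convex envelope). -/
def biconj {d : ℕ} (f : Euc d → EReal) : Euc d → EReal := fenchelConj (fenchelConj f)

/-- Proper, 1-coercive (`f x / ‖x‖ → +∞` as `‖x‖ → +∞`), lower semicontinuous, and minorized by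
an affine function. -/
structure GoodFunction {d : ℕ} (f : Euc d → EReal) : Prop where
  ne_bot : ∀ x, f x ≠ ⊥
  exists_lt_top : ∃ x, f x < ⊤
  coercive : ∀ M : ℝ, ∀ᶠ x in Bornology.cobounded (Euc d), ((M * ‖x‖ : ℝ) : EReal) ≤ f x
  lsc : LowerSemicontinuous f
  affine_minorant : ∃ (y : Euc d) (r : ℝ), ∀ x, ((inner ℝ y x + r : ℝ) : EReal) ≤ f x

/-- The `k`-th nonconvexity measure: the largest value of `f (∑ αⱼ xⱼ) - ∑ αⱼ f (xⱼ)` over `d + 1`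
points of the domain of `f` and convex weights with at most `k` nonzero entries. The barycentre is
not required to lie in the domain: the measure is `⊤` if it can leave it. -/
def rhoK {d : ℕ} (f : Euc d → EReal) (k : ℕ) : EReal :=
  ⨆ (x : Fin (d + 1) → Euc d) (α : Fin (d + 1) → ℝ)
    (_ : (∀ j, f (x j) < ⊤) ∧ (∀ j, 0 ≤ α j) ∧ ∑ j, α j = 1 ∧
      (Finset.univ.filter fun j => α j ≠ 0).card ≤ k),
    f (∑ j, α j • x j) - ∑ j, (α j : EReal) * f (x j)

/-- The data of a separable problem: minimize `∑ i, f i (x i)` subject to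
`∑ i, A i (x i) ≤ b` (`m` inequalities). The constraints `x i ∈ Y i` are absorbed in the
extended-real-valued `f i`; `A i` is the `i`-th column block of the constraint matrix. -/
structure SepProblem (n m : ℕ) where
  d : Fin n → ℕ
  f : (i : Fin n) → Euc (d i) → EReal
  A : (i : Fin n) → Matrix (Fin m) (Fin (d i)) ℝ
  b : Euc m

namespace SepProblem

variable {n m : ℕ} (P : SepProblem n m)

/-- The variable of the problem, in blocks. -/
abbrev Var : Type := (i : Fin n) → Euc (P.d i)

/-- `A i x`, as a Euclidean vector. -/
def block (i : Fin n) (x : Euc (P.d i)) : Euc m :=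
  WithLp.toLp 2 ((P.A i).mulVec (WithLp.ofLp x))

/-- `A x = ∑ i, A i (x i)`. -/
def mulA (x : P.Var) : Euc m := ∑ i, P.block i (x i)

/-- Feasibility for the perturbed constraint `A x - b ≤ u`. -/
def Feasible (u : Euc m) (x : P.Var) : Prop := ∀ k, (P.mulA x - P.b) k ≤ u k

/-- Optimal value of the perturbed nonconvex problem. -/
def hP (u : Euc m) : EReal :=
  ⨅ (x : P.Var) (_ : P.Feasible u x), ∑ i, P.f i (x i)

/-- Optimal value of the perturbed convex relaxation. -/
def hCoP (u : Euc m) : EReal :=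
  ⨅ (x : P.Var) (_ : P.Feasible u x), ∑ i, biconj (P.f i) (x i)

/-- `x` attains the (finite) optimal value of the unperturbed convex relaxation. -/
def IsRelaxedOptimal (x : P.Var) : Prop :=
  P.Feasible 0 x ∧ (∀ i, biconj (P.f i) (x i) < ⊤) ∧
    ∑ i, biconj (P.f i) (x i) = P.hCoP 0

/-- The projected epigraph of the nonconvex problem. -/
def epiG : Set (EpiSpace m) :=
  {r | ∃ x : P.Var, ∑ i, P.f i (x i) ≤ (r.fst : EReal) ∧ P.Feasible r.snd x}

/-- Its closed convex hull. -/
def epiGHull : Set (EpiSpace m) := closure (convexHull ℝ P.epiG)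

/-- The Lagrange dual function. -/
def dualFun (l : Euc m) : EReal :=
  ⨅ r ∈ P.epiGHull, ((r.fst + inner ℝ l r.snd : ℝ) : EReal)

/-- `l` is an optimal solution of the dual problem: maximize the dual function over `l ≥ 0`. -/
def IsDualOptimal (l : Euc m) : Prop :=
  (∀ k, 0 ≤ l k) ∧ ∀ l' : Euc m, (∀ k, 0 ≤ l' k) → P.dualFun l' ≤ P.dualFun l

/-- `r` lies in the closed convex hull of the epigraph and attains the infimum that defines the
dual function at the optimal dual variables. -/
def IsDualMinimizer (r : EpiSpace m) : Prop :=
  r ∈ P.epiGHull ∧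
    ∀ l, P.IsDualOptimal l → ((r.fst + inner ℝ l r.snd : ℝ) : EReal) = P.dualFun l

/-- The set `𝓕ᵢ` of all `(fᵢ** (x), Aᵢ x)` with `fᵢ** (x)` finite. -/
def setF (i : Fin n) : Set (EpiSpace m) :=
  {r | ∃ x, (r.fst : EReal) = biconj (P.f i) x ∧ r.snd = P.block i x}

/-- The points of `𝓕ᵢ` that come from a point `x` with `fᵢ (x) = fᵢ** (x)`. -/
def contactF (i : Fin n) : Set (EpiSpace m) :=
  {r | ∃ x, (r.fst : EReal) = biconj (P.f i) x ∧ P.f i x = biconj (P.f i) x ∧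
    r.snd = P.block i x}

/-- `∑ i, (fᵢ** (xᵢ), Aᵢ xᵢ)`, for `x` with all `fᵢ** (xᵢ)` finite. -/
def sumPoint (x : P.Var) : EpiSpace m :=
  ∑ i, WithLp.toLp 2 ((biconj (P.f i) (x i)).toReal, P.block i (x i))

/-- The point `z* = ∑ i, (fᵢ** (xᵢ), Aᵢ xᵢ) + (0, w - b)`. -/
def zStar (x : P.Var) (w : Euc m) : EpiSpace m :=
  P.sumPoint x + WithLp.toLp 2 ((0 : ℝ), w - P.b)

/-- Convex weights `lam i ·` on `m + 2` points `z i ·`, for each `i`; the points lie in `𝓕ᵢ` and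
come from points where `fᵢ` agrees with its convex envelope. -/
def IsCombination (lam : Fin n → Fin (m + 2) → ℝ) (z : Fin n → Fin (m + 2) → EpiSpace m) : Prop :=
  (∀ i j, 0 ≤ lam i j) ∧ (∀ i, ∑ j, lam i j = 1) ∧ ∀ i j, z i j ∈ P.contactF i

/-- Total number of nonzero coefficients. -/
def numNonzero (lam : Fin n → Fin (m + 2) → ℝ) : ℕ :=
  ∑ i, (Finset.univ.filter fun j => lam i j ≠ 0).card

/-- `x` is optimal for the convex relaxation, `w ≥ 0`, the point `z*` formed with `x` and `w`
is a minimizer in the dual function, and `lam`, `z` represent it: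
`z* = ∑ i, ∑ j, lam i j • z i j + (0, w - b)`, with at most `n + m + 1` nonzero coefficients. -/
def IsOptimalRepresentation (x : P.Var) (w : Euc m) (lam : Fin n → Fin (m + 2) → ℝ)
    (z : Fin n → Fin (m + 2) → EpiSpace m) : Prop :=
  P.IsRelaxedOptimal x ∧ (∀ k, 0 ≤ w k) ∧ P.IsDualMinimizer (P.zStar x w) ∧
    P.IsCombination lam z ∧
    P.zStar x w = ∑ i, ∑ j, lam i j • z i j + WithLp.toLp 2 ((0 : ℝ), w - P.b) ∧
    numNonzero lam ≤ n + m + 1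

/-- `u` is the error `∑ i, ∑ j, mu i j • y i j + (0, w - b) - z*` of an approximation of `z*` that
uses at most `s` nonzero coefficients. -/
def IsSparseError (zs : EpiSpace m) (w : Euc m) (s : ℝ) (u : EpiSpace m) : Prop :=
  ∃ (mu : Fin n → Fin (m + 2) → ℝ) (y : Fin n → Fin (m + 2) → EpiSpace m),
    P.IsCombination mu y ∧ (numNonzero mu : ℝ) ≤ s ∧
    u = ∑ i, ∑ j, mu i j • y i j + WithLp.toLp 2 ((0 : ℝ), w - P.b) - zs

/-- `max {∑ i, ρ_{βᵢ} (fᵢ) : βᵢ ∈ [1, m + 2], ∑ i, βᵢ ≤ s}`, over integers `βᵢ`. -/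
def maxRho (s : ℝ) : EReal :=
  ⨆ (β : Fin n → ℕ) (_ : (∀ i, 1 ≤ β i ∧ β i ≤ m + 2) ∧ ((∑ i, β i : ℕ) : ℝ) ≤ s),
    ∑ i, rhoK (P.f i) (β i)

/-- `max ‖lam i j • z i j‖` over `lam i j ≠ 1` (zero if there is no such pair). -/
def radiusV (lam : Fin n → Fin (m + 2) → ℝ) (z : Fin n → Fin (m + 2) → EpiSpace m) : ENNReal :=
  ⨆ (i : Fin n) (j : Fin (m + 2)) (_ : lam i j ≠ 1), ‖lam i j • z i j‖ₑ

/-- `max |lam i j|` over `lam i j ≠ 1` (zero if there is no such pair). -/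
def radiusLam (lam : Fin n → Fin (m + 2) → ℝ) : ENNReal :=
  ⨆ (i : Fin n) (j : Fin (m + 2)) (_ : lam i j ≠ 1), ‖lam i j‖ₑ

/-- `sup ‖∑ i, a i • v i‖` over `‖a‖ ≤ 1` and `v i ∈ 𝓕ᵢ`, possibly infinite. -/
def MV : ENNReal :=
  ⨆ (a : Euc n) (_ : ‖a‖ ≤ 1) (v : Fin n → EpiSpace m) (_ : ∀ i, v i ∈ P.setF i),
    ‖∑ i, a i • v i‖ₑ

/-- The duality gap bound for the perturbation `u = (u₁, u₂)` and sparsity `s`. -/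
def GapBound (s : ℝ) (u : EpiSpace m) : Prop :=
  P.hCoP u.snd ≤ P.hP u.snd ∧
    P.hP u.snd ≤ P.hCoP 0 + (((|u.fst| : ℝ) : EReal) + P.maxRho s)

end SepProblem

end

/-! The constant is c = 4. Two facts about the relaxation carry the theorem.

Existence. Each envelope value is attained by a finite convex combination of contact points
(`GoodFunction.exists_contact_combination`): coercivity makes the cone over the epigraph closed with
a compact base, so a separating functional would be an affine minorant contradicting the envelope
value. Sums of such combinations in dimension m + 1 are thinned to n + m + 1 coefficients by
Shapley–Folkman. The relaxed epigraph is closed, convex and contains the hull of the nonconvex one,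
so Hahn–Banach gives strong duality, and w = 0 makes the optimal point a dual minimizer.

Gap. Averaging the preimages of the contact points of any sparse error u gives a point feasible for
the perturbation u₂; its cost is the relaxed optimum plus u₁ plus the nonconvexity measures at the
support sizes (`IsSparseError.gapBound`). Smallness of u plays no role here.

It remains to find a small sparse error. If the given weights are too numerous, the blocks
concentrated on one point are kept, and each of the p ≤ m + 1 others is replaced by an empirical
average of q sampled points. Maurey's second-moment argument bounds the squared error by
N·R_v·M_V/q, with N the number of weights in the sampled blocks. Since p ≤ N·R_λ, AM–GM turns this
product into the square of R_v + R_λ·M_V (`variance_le`). -/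

/-! ### Carathéodory reductions and compact convex hulls -/

/-- A nonnegative combination of vectors on an affine hyperplane avoiding the origin can be
replaced, without increasing a linear cost, by one supported on at most `finrank` of them. -/
theorem exists_basic_solution {ι V : Type*} [Fintype ι] [AddCommGroup V] [Module ℝ V]
    [FiniteDimensional ℝ V] (v : ι → V) (c : ι → ℝ) (φ : V →ₗ[ℝ] ℝ) (hφ : ∀ i, φ (v i) = 1)
    (w : ι → ℝ) (hw : ∀ i, 0 ≤ w i) :
    ∃ w' : ι → ℝ, (∀ i, 0 ≤ w' i) ∧ (∀ i, w i = 0 → w' i = 0) ∧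
      ∑ i, w' i • v i = ∑ i, w i • v i ∧ ∑ i, w' i * c i ≤ ∑ i, w i * c i ∧
      (Finset.univ.filter fun i => w' i ≠ 0).card ≤ Module.finrank ℝ V := by
  classical
  induction hn : (Finset.univ.filter fun i => w i ≠ 0).card using Nat.strong_induction_on
    generalizing w with
  | _ n ih =>
    by_cases hcard : n ≤ Module.finrank ℝ V
    · exact ⟨w, hw, fun _ h => h, rfl, le_rfl, hn ▸ hcard⟩
    have hdep : ¬ LinearIndependent ℝ (fun i : {i // w i ≠ 0} => v i) := by
      intro hli
      have := hli.fintype_card_le_finrank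
      rw [Fintype.card_subtype, hn] at this
      exact hcard this
    obtain ⟨g, hg, i₁, hi₁⟩ := Fintype.not_linearIndependent_iff.1 hdep
    have key : ∃ δ : ι → ℝ, (∀ i, w i = 0 → δ i = 0) ∧ ∑ i, δ i • v i = 0 ∧
        ∑ i, δ i * c i ≤ 0 ∧ ∃ i, δ i ≠ 0 := by
      let δ : ι → ℝ := fun i => if h : w i ≠ 0 then g ⟨i, h⟩ else 0
      have h0 : ∀ i, w i = 0 → δ i = 0 := fun i hi => by simp [δ, hi]
      have h1 : ∑ i, δ i • v i = 0 := by
        rw [← hg]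
        refine (Fintype.sum_of_injective Subtype.val Subtype.val_injective _ _ ?_ ?_).symm
        · intro i hi
          rw [h0 i, zero_smul]
          by_contra hne
          exact hi ⟨⟨i, hne⟩, rfl⟩
        · rintro ⟨i, hi⟩
          simp [δ, hi]
      have h2 : δ i₁ ≠ 0 := by
        have := i₁.2
        simpa [δ, this] using hi₁
      rcases le_total (∑ i, δ i * c i) 0 with h | h
      · exact ⟨δ, h0, h1, h, _, h2⟩
      · refine ⟨fun i => -δ i, fun i hi => by simp [h0 i hi], ?_, ?_, i₁, by simpa using h2⟩
        · simp [h1]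
        · simpa using h
    obtain ⟨δ, h0, h1, h2, i₂, h3⟩ := key
    -- `φ` makes the coefficients of the dependence sum to zero, so a nonzero `δ` has a negative
    -- entry whatever sign was chosen to keep the cost from rising.
    have hsum : ∑ i, δ i = 0 := by
      have := congrArg φ h1
      simpa [hφ] using this
    have hneg : ∃ i, δ i < 0 := by
      by_contra! hall
      exact h3 ((Finset.sum_eq_zero_iff_of_nonneg fun i _ => hall i).1 hsum i₂
        (Finset.mem_univ _))
    obtain ⟨i₄, hi₄⟩ := hneg
    -- Ratio test: the minimal quotient is the longest step along `δ` that keeps all weights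
    -- nonnegative, and it kills the weight at `i₀`.
    obtain ⟨i₀, hi₀, hmin⟩ := Finset.exists_min_image (Finset.univ.filter fun i => δ i < 0)
      (fun i => w i / -δ i) ⟨i₄, by simpa using hi₄⟩
    simp only [Finset.mem_filter, Finset.mem_univ, true_and] at hi₀ hmin
    set t := w i₀ / -δ i₀ with ht
    have ht0 : 0 ≤ t := div_nonneg (hw _) (by linarith)
    have hz : w i₀ + t * δ i₀ = 0 := by
      rw [ht, div_neg, neg_mul, div_mul_cancel₀ _ hi₀.ne, add_neg_cancel]
    have hne : w i₀ ≠ 0 := fun h => hi₀.ne (h0 _ h)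
    have hlt : (Finset.univ.filter fun i => w i + t * δ i ≠ 0).card < n := by
      rw [← hn]
      refine Finset.card_lt_card ⟨?_, ?_⟩
      · intro i hi
        simp only [Finset.mem_filter, Finset.mem_univ, true_and] at hi ⊢
        exact fun h => hi (by simp [h, h0 i h])
      · intro hsub
        have := hsub (by simpa using hne : i₀ ∈ Finset.univ.filter fun i => w i ≠ 0)
        simp [hz] at this
    have hnn : ∀ i, 0 ≤ w i + t * δ i := by
      intro i
      rcases lt_or_ge (δ i) 0 with h | h
      · have h4 := hmin i h
        rw [le_div_iff₀ (by linarith)] at h4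
        linarith
      · exact add_nonneg (hw i) (mul_nonneg ht0 h)
    obtain ⟨w', a1, a2, a3, a4, a5⟩ := ih _ hlt (fun i => w i + t * δ i) hnn rfl
    refine ⟨w', a1, fun i hi => a2 i (by simp [hi, h0 i hi]), ?_, ?_, a5⟩
    · rw [a3]
      simp only [add_smul, Finset.sum_add_distrib, mul_smul, ← Finset.smul_sum, h1, smul_zero,
        add_zero]
    · refine a4.trans ?_
      simp only [add_mul, Finset.sum_add_distrib, mul_assoc, ← Finset.mul_sum]
      nlinarith

/-- A combination with at most `N` nonzero coefficients can be indexed by `Fin N`. -/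
theorem exists_reindex {ι : Type*} [Fintype ι] [Nonempty ι] (w : ι → ℝ) {N : ℕ}
    (h : (Finset.univ.filter fun i => w i ≠ 0).card ≤ N) :
    ∃ (g : Fin N → ι) (w' : Fin N → ℝ), (∀ j, w' j = 0 ∨ w' j = w (g j)) ∧
      (Finset.univ.filter fun j => w' j ≠ 0).card = (Finset.univ.filter fun i => w i ≠ 0).card ∧
      ∀ (M : Type) [AddCommMonoid M] (F : ι → ℝ → M), (∀ i, F i 0 = 0) → ∑ j, F (g j) (w' j) = ∑ i, F i (w i) := by
  classical
  have hc : Fintype.card {i // w i ≠ 0} ≤ Fintype.card (Fin N) := by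
    rwa [Fintype.card_subtype, Fintype.card_fin]
  obtain ⟨e⟩ := Function.Embedding.nonempty_of_card_le hc
  -- Unused slots receive an arbitrary index and weight zero.
  let g : Fin N → ι := Function.extend e Subtype.val (fun _ => Classical.arbitrary ι)
  let w' : Fin N → ℝ := Function.extend e (fun i => w i.1) 0
  have hw' : ∀ i, w' (e i) = w i.1 := fun i => e.injective.extend_apply _ _ _
  have hg : ∀ i, g (e i) = i.1 := fun i => e.injective.extend_apply _ _ _
  have hout : ∀ j, j ∉ Set.range e → w' j = 0 := fun j hj =>
    Function.extend_apply' _ _ _ (by simpa using hj)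
  refine ⟨g, w', fun j => ?_, ?_, fun M _ F hF => ?_⟩
  · by_cases hj : j ∈ Set.range e
    · obtain ⟨i, rfl⟩ := hj
      right; rw [hw', hg]
    · exact Or.inl (hout j hj)
  · have : (Finset.univ.filter fun j => w' j ≠ 0) = Finset.univ.map e := by
      ext j
      simp only [Finset.mem_filter, Finset.mem_univ, true_and, Finset.mem_map]
      constructor
      · intro hj
        by_contra hcon
        exact hj (hout j (by simpa using hcon))
      · rintro ⟨i, rfl⟩
        rw [hw']; exact i.2
    rw [this, Finset.card_map, Finset.card_univ, Fintype.card_subtype]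
  · trans ∑ i : {i // w i ≠ 0}, F i.1 (w i.1)
    · refine (Fintype.sum_of_injective e e.injective _ _ (fun j hj => ?_) fun i => ?_).symm
      · rw [hout j hj, hF]
      · rw [hw', hg]
    · refine Fintype.sum_of_injective _ Subtype.val_injective _ _ (fun i hi => ?_) fun i => rfl
      have : w i = 0 := by
        by_contra hne
        exact hi ⟨⟨i, hne⟩, rfl⟩
      rw [this, hF]

/-- In finite dimension the convex hull of a compact set is compact. -/
theorem IsCompact.convexHull_of_finiteDimensional {V : Type} [NormedAddCommGroup V]
    [NormedSpace ℝ V] [FiniteDimensional ℝ V] {B : Set V} (hB : IsCompact B) :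
    IsCompact (convexHull ℝ B) := by
  rcases B.eq_empty_or_nonempty with rfl | ⟨b₀, hb₀⟩
  · simp
  -- A last coordinate 1 turns conic into convex combinations, so dim V + 1 points always suffice
  -- and the hull is a continuous image of a compact set.
  set N := Module.finrank ℝ (V × ℝ) with hN
  let Φ : (Fin N → ℝ) × (Fin N → V) → V := fun p => ∑ j, p.1 j • p.2 j
  have hΦ : Continuous Φ := by fun_prop
  have hK : IsCompact ((stdSimplex ℝ (Fin N)) ×ˢ (Set.univ.pi fun _ : Fin N => B)) :=
    (isCompact_stdSimplex ℝ (Fin N)).prod (isCompact_univ_pi fun _ => hB)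
  convert hK.image hΦ using 1
  refine Set.Subset.antisymm (fun x hx => ?_) ?_
  · obtain ⟨ι, _, w, z, hw, hw1, hz, rfl⟩ := mem_convexHull_iff_exists_fintype.1 hx
    obtain ⟨w₁, h1, -, h3, -, h5⟩ := exists_basic_solution (fun i => (z i, (1 : ℝ))) 0
      (LinearMap.snd ℝ V ℝ) (fun _ => rfl) w hw
    have hne : Nonempty ι := by
      by_contra hcon
      rw [not_nonempty_iff] at hcon
      simp at hw1
    obtain ⟨g, w₂, k1, -, k3⟩ := exists_reindex w₁ h5
    have e1 : ∑ i, w₁ i • z i = ∑ i, w i • z i := by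
      simpa [Prod.fst_sum] using congrArg Prod.fst h3
    have e2 : ∑ i, w₁ i = 1 := by
      simpa [Prod.snd_sum, hw1] using congrArg Prod.snd h3
    refine ⟨(w₂, fun j => z (g j)), ⟨⟨fun j => ?_, ?_⟩, fun j _ => hz _⟩, ?_⟩
    · change 0 ≤ w₂ j
      rcases k1 j with h | h <;> rw [h]
      exact h1 _
    · rw [← e2]; exact k3 ℝ (fun _ a => a) fun _ => rfl
    · rw [← e1]; exact k3 V (fun i a => a • z i) fun _ => zero_smul _ _
  · rintro _ ⟨⟨w, z⟩, ⟨⟨hw0, hw1⟩, hz⟩, rfl⟩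
    exact mem_convexHull_of_exists_fintype w z hw0 hw1 (fun i => hz i trivial) rfl

/-! ### The biconjugate as a supremum of affine minorants -/

section Biconjugate

variable {d : ℕ} {f : Euc d → EReal}

/-- Coercivity controls the outside of a ball and the affine minorant the inside, so linear growth
of every slope holds globally. -/
theorem GoodFunction.exists_norm_le (hf : GoodFunction f) (M : ℝ) :
    ∃ C : ℝ, ∀ x, ((M * ‖x‖ - C : ℝ) : EReal) ≤ f x := by
  obtain ⟨y, r, hyr⟩ := hf.affine_minorant
  have h := hf.coercive M
  rw [← comap_norm_atTop, Filter.eventually_comap] at h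
  obtain ⟨R, hR⟩ := Filter.eventually_atTop.1 h
  refine ⟨(|M| + ‖y‖) * |R| + |r|, fun x => ?_⟩
  have hM : M * ‖x‖ ≤ |M| * ‖x‖ := mul_le_mul_of_nonneg_right (le_abs_self M) (norm_nonneg _)
  have h0 : 0 ≤ (|M| + ‖y‖) * |R| := by positivity
  rcases le_or_gt R ‖x‖ with hx | hx
  · refine le_trans ?_ (hR _ hx x rfl)
    exact_mod_cast (by linarith [abs_nonneg r])
  · refine le_trans ?_ (hyr x)
    norm_cast
    have h1 := abs_real_inner_le_norm y x
    have h2 : ‖x‖ ≤ |R| := hx.le.trans (le_abs_self R)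
    have h3 := neg_abs_le (inner ℝ y x)
    have h4 := neg_abs_le r
    have h5 : (|M| + ‖y‖) * ‖x‖ ≤ (|M| + ‖y‖) * |R| :=
      mul_le_mul_of_nonneg_left h2 (by positivity)
    nlinarith

theorem le_biconj_of_minorant {y : Euc d} {r : ℝ}
    (h : ∀ z, ((inner ℝ y z + r : ℝ) : EReal) ≤ f z) (x : Euc d) :
    ((inner ℝ y x + r : ℝ) : EReal) ≤ biconj f x := by
  have h1 : fenchelConj f y ≤ ((-r : ℝ) : EReal) := by
    refine iSup_le fun z => ?_
    have hz := h z
    induction hfz : f z with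
    | bot => rw [hfz] at hz; exact absurd hz (by simp [EReal.coe_ne_bot])
    | top => simp
    | coe a =>
      rw [hfz] at hz
      norm_cast at hz ⊢
      linarith
  refine le_trans ?_ (le_iSup (fun z => ((inner ℝ x z : ℝ) : EReal) - fenchelConj f z) y)
  refine le_trans ?_ (EReal.sub_le_sub le_rfl h1)
  rw [real_inner_comm y x]
  norm_cast
  simp

/-- This description by affine minorants is all that is used of the biconjugate later: convexity,
closedness and the separation argument read off from it. Properness excludes a conjugate value `⊥`.
-/
theorem biconj_le_iff (hbot : ∀ x, f x ≠ ⊥) (hprop : ∃ x, f x < ⊤) {x : Euc d} {t : ℝ} :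
    biconj f x ≤ t ↔ ∀ (y : Euc d) (r : ℝ), (∀ z, ((inner ℝ y z + r : ℝ) : EReal) ≤ f z) →
      inner ℝ y x + r ≤ t := by
  constructor
  · intro h y r hyr
    exact_mod_cast (le_biconj_of_minorant hyr x).trans h
  · intro h
    refine iSup_le fun y => ?_
    induction hy : fenchelConj f y with
    | top => simp
    | bot =>
      obtain ⟨x₀, hx₀⟩ := hprop
      have h1 : ((inner ℝ y x₀ : ℝ) : EReal) - f x₀ ≤ ⊥ := hy ▸ le_iSup (fun z =>
        ((inner ℝ y z : ℝ) : EReal) - f z) x₀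
      lift f x₀ to ℝ using ⟨hx₀.ne, hbot x₀⟩ with a
      rw [← EReal.coe_sub] at h1
      exact absurd (le_bot_iff.1 h1) (EReal.coe_ne_bot _)
    | coe c =>
      have h1 : inner ℝ y x + -c ≤ t := by
        refine h y (-c) fun z => ?_
        have h2 : ((inner ℝ y z : ℝ) : EReal) - f z ≤ (c : EReal) := hy ▸ le_iSup (fun z =>
          ((inner ℝ y z : ℝ) : EReal) - f z) z
        by_cases hz : f z = ⊤
        · simp [hz]
        · lift f z to ℝ using ⟨hz, hbot z⟩ with a
          norm_cast at h2 ⊢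
          linarith
      rw [real_inner_comm]
      norm_cast

theorem biconj_le_self (hbot : ∀ x, f x ≠ ⊥) (hprop : ∃ x, f x < ⊤) (x : Euc d) :
    biconj f x ≤ f x := by
  by_cases hx : f x = ⊤
  · simp [hx]
  · have h1 : (((f x).toReal : ℝ) : EReal) = f x := EReal.coe_toReal hx (hbot x)
    rw [← h1, biconj_le_iff hbot hprop]
    intro y r hyr
    have := hyr x
    rw [← h1] at this
    exact_mod_cast this

namespace GoodFunction

theorem biconj_le_self (hf : GoodFunction f) (x : Euc d) : biconj f x ≤ f x :=
  _root_.biconj_le_self hf.ne_bot hf.exists_lt_top x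

theorem biconj_ne_bot (hf : GoodFunction f) (x : Euc d) : biconj f x ≠ ⊥ := by
  obtain ⟨y, r, hyr⟩ := hf.affine_minorant
  exact ne_bot_of_le_ne_bot (EReal.coe_ne_bot _) (le_biconj_of_minorant hyr x)

theorem coe_toReal_biconj (hf : GoodFunction f) {x : Euc d} (hx : biconj f x < ⊤) :
    (((biconj f x).toReal : ℝ) : EReal) = biconj f x :=
  EReal.coe_toReal hx.ne (hf.biconj_ne_bot x)

theorem exists_norm_le_biconj (hf : GoodFunction f) : ∃ C : ℝ, ∀ x, ((‖x‖ - C : ℝ) : EReal) ≤ biconj f x := by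
  obtain ⟨C, hC⟩ := hf.exists_norm_le 1
  refine ⟨C, fun x => ?_⟩
  -- The minorant of `f` in the unit direction of `x` equals ‖x‖ − C at `x`. At `x = 0` the
  -- convention 0⁻¹ = 0 still gives a valid one.
  have h := le_biconj_of_minorant (f := f) (y := ‖x‖⁻¹ • x) (r := -C) (fun z => by
    refine le_trans ?_ (hC z)
    norm_cast
    have h1 := real_inner_le_norm (‖x‖⁻¹ • x) z
    have h2 : ‖‖x‖⁻¹ • x‖ ≤ 1 := by
      rw [norm_smul, norm_inv, norm_norm]
      exact inv_mul_le_one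
    nlinarith [norm_nonneg z]) x
  refine le_trans ?_ h
  norm_cast
  rw [real_inner_smul_left, real_inner_self_eq_norm_sq]
  rcases eq_or_ne ‖x‖ 0 with h0 | h0
  · simp [h0, sub_eq_add_neg]
  · rw [pow_two, ← mul_assoc, inv_mul_cancel₀ h0, one_mul, sub_eq_add_neg]

/-- Jensen's inequality for the biconjugate. -/
theorem biconj_sum_le (hf : GoodFunction f) {ι : Type*} [Fintype ι] {w : ι → ℝ} (hw : ∀ i, 0 ≤ w i)
    (hw1 : ∑ i, w i = 1) {z : ι → Euc d} {t : ι → ℝ} (hz : ∀ i, biconj f (z i) ≤ t i) :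
    biconj f (∑ i, w i • z i) ≤ ((∑ i, w i * t i : ℝ) : EReal) := by
  rw [biconj_le_iff hf.ne_bot hf.exists_lt_top]
  intro y r hyr
  have : inner ℝ y (∑ i, w i • z i) + r = ∑ i, w i * (inner ℝ y (z i) + r) := by
    simp only [inner_sum, real_inner_smul_right, mul_add, Finset.sum_add_distrib,
      ← Finset.sum_mul, hw1, one_mul]
  rw [this]
  exact Finset.sum_le_sum fun i _ => mul_le_mul_of_nonneg_left
    ((biconj_le_iff hf.ne_bot hf.exists_lt_top).1 (hz i) y r hyr) (hw i)

theorem isClosed_epi_biconj (hf : GoodFunction f) :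
    IsClosed {p : Euc d × ℝ | biconj f p.1 ≤ (p.2 : EReal)} := by
  simp only [biconj_le_iff hf.ne_bot hf.exists_lt_top, Set.ofPred_forall]
  refine isClosed_iInter fun y => isClosed_iInter fun r => isClosed_iInter fun _ => ?_
  exact isClosed_le (by fun_prop) (by fun_prop)

end GoodFunction

end Biconjugate

/-! ### The cone over the epigraph, and attainment of the envelope -/

section EpigraphCone

variable {d : ℕ} {f : Euc d → EReal}

/-- The closed cone generated by `{1} × epi f`, for a `1`-coercive function. -/
def epiCone (f : Euc d → EReal) : Set (ℝ × Euc d × ℝ) :=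
  {k | (0 < k.1 ∧ f (k.1⁻¹ • k.2.1) ≤ ((k.1⁻¹ * k.2.2 : ℝ) : EReal)) ∨
    (k.1 = 0 ∧ k.2.1 = 0 ∧ 0 ≤ k.2.2)}

theorem nonneg_of_mem_epiCone {k : ℝ × Euc d × ℝ} (hk : k ∈ epiCone f) : 0 ≤ k.1 := by
  rcases hk with h | h
  · exact h.1.le
  · exact h.1.ge

theorem le_of_mem_epiCone {M C : ℝ} (hC : ∀ x, ((M * ‖x‖ - C : ℝ) : EReal) ≤ f x)
    {k : ℝ × Euc d × ℝ} (hk : k ∈ epiCone f) : M * ‖k.2.1‖ - C * k.1 ≤ k.2.2 := by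
  rcases hk with ⟨h1, h2⟩ | ⟨h1, h2, h3⟩
  · have h := (hC _).trans h2
    norm_cast at h
    rw [norm_smul, norm_inv, Real.norm_of_nonneg h1.le] at h
    have := mul_le_mul_of_nonneg_left h h1.le
    field_simp at this
    linarith
  · simp [h1, h2, h3]

theorem smul_mem_epiCone {k : ℝ × Euc d × ℝ} (hk : k ∈ epiCone f) {a : ℝ} (ha : 0 < a) :
    a • k ∈ epiCone f := by
  rcases hk with ⟨h1, h2⟩ | ⟨h1, h2, h3⟩
  · left
    have e : (a * k.1)⁻¹ * a = k.1⁻¹ := by field_simp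
    refine ⟨mul_pos ha h1, ?_⟩
    simp only [Prod.smul_fst, Prod.smul_snd, smul_eq_mul, smul_smul, ← mul_assoc, e]
    exact h2
  · right
    simp [h1, h2]
    positivity

namespace GoodFunction

/-- When the scale tends to 0, growth of every slope M forces M‖a‖ ≤ τ in the limit, hence a = 0:
the only recession direction is vertical. At positive scales lower semicontinuity suffices. -/
theorem isClosed_epiCone (hf : GoodFunction f) : IsClosed (epiCone f) := by
  refine isClosed_of_closure_subset fun k hk => ?_
  obtain ⟨u, hu, hlim⟩ := mem_closure_iff_seq_limit.1 hk
  have h1 : Filter.Tendsto (fun n => (u n).1) Filter.atTop (nhds k.1) :=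
    (continuous_fst.tendsto k).comp hlim
  have h2 : Filter.Tendsto (fun n => (u n).2.1) Filter.atTop (nhds k.2.1) :=
    ((continuous_fst.comp continuous_snd).tendsto k).comp hlim
  have h3 : Filter.Tendsto (fun n => (u n).2.2) Filter.atTop (nhds k.2.2) :=
    ((continuous_snd.comp continuous_snd).tendsto k).comp hlim
  have h0 : 0 ≤ k.1 := ge_of_tendsto' h1 fun n => nonneg_of_mem_epiCone (hu n)
  rcases h0.eq_or_lt with h0 | h0
  · have hb : ∀ M : ℝ, M * ‖k.2.1‖ ≤ k.2.2 := by
      intro M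
      obtain ⟨C, hC⟩ := hf.exists_norm_le M
      have := le_of_tendsto_of_tendsto' ((h2.norm.const_mul M).sub (h1.const_mul C)) h3
        fun n => le_of_mem_epiCone hC (hu n)
      simpa [← h0] using this
    refine Or.inr ⟨h0.symm, ?_, by simpa using hb 0⟩
    by_contra hne
    have hpos := norm_pos_iff.2 hne
    have := hb ((k.2.2 + 1) / ‖k.2.1‖)
    rw [div_mul_cancel₀ _ hpos.ne'] at this
    linarith
  · refine Or.inl ⟨h0, ?_⟩
    have hcl : IsClosed {p : Euc d × ℝ | f p.1 ≤ (p.2 : EReal)} :=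
      hf.lsc.isClosed_epigraph.preimage
        (continuous_fst.prodMk (continuous_coe_real_ereal.comp continuous_snd))
    have h4 := h1.inv₀ h0.ne'
    refine hcl.mem_of_tendsto ((h4.smul h2).prodMk_nhds (h4.mul h3)) ?_
    filter_upwards [h1.eventually (lt_mem_nhds h0)] with n hn
    rcases hu n with h | h
    · exact h.2
    · exact absurd h.1 hn.ne'

/-- On the cone τ + (C + 1)α ≥ ‖a‖ + α, so fixing the left side to 1 bounds every coordinate. -/
theorem isCompact_base_epiCone (hf : GoodFunction f) {C : ℝ}
    (hC : ∀ x, ((1 * ‖x‖ - C : ℝ) : EReal) ≤ f x) :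
    IsCompact (epiCone f ∩ {k | k.2.2 + (C + 1) * k.1 = 1}) := by
  refine Metric.isCompact_of_isClosed_isBounded
    (hf.isClosed_epiCone.inter (isClosed_eq (by fun_prop) (by fun_prop))) ?_
  refine (Metric.isBounded_closedBall (x := (0 : ℝ × Euc d × ℝ)) (r := 1 + |C + 1|)).subset ?_
  rintro ⟨α, a, τ⟩ ⟨hk, hk1⟩
  have h0 := nonneg_of_mem_epiCone hk
  have h1 := le_of_mem_epiCone hC hk
  simp only [Set.mem_ofPred_eq] at hk1 h0 h1
  have hα : α ≤ 1 := by nlinarith [norm_nonneg a]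
  have h2 : |(C + 1) * α| ≤ |C + 1| := by
    rw [abs_mul, abs_of_nonneg h0]
    exact mul_le_of_le_one_right (abs_nonneg _) hα
  have h3 := abs_nonneg (C + 1)
  rw [mem_closedBall_zero_iff]
  refine norm_prod_le_iff.2 ⟨?_, norm_prod_le_iff.2 ⟨?_, ?_⟩⟩
  · rw [Real.norm_of_nonneg h0]; linarith
  · simp only; nlinarith
  · simp only [Real.norm_eq_abs]
    have : τ = 1 - (C + 1) * α := by linarith
    rw [this]
    refine (abs_sub _ _).trans ?_
    simpa using h2

/-- If the ray through (1, x, t) missed the compact hull of the base, a functional separating them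
would be below a negative `u` on the base and nonnegative on the ray. Solving for the vertical
coordinate gives an affine minorant of `f` exceeding t at x. -/
theorem exists_mem_convexHull_base (hf : GoodFunction f) {C : ℝ}
    (hC : ∀ x, ((1 * ‖x‖ - C : ℝ) : EReal) ≤ f x) {x : Euc d} {t : ℝ}
    (hx : biconj f x ≤ t) :
    ∃ a : ℝ, 0 ≤ a ∧
      a • ((1 : ℝ), x, t) ∈ convexHull ℝ (epiCone f ∩ {k | k.2.2 + (C + 1) * k.1 = 1}) := by
  by_contra! hcon
  set p : ℝ × Euc d × ℝ := (1, x, t) with hp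
  set B := epiCone f ∩ {k | k.2.2 + (C + 1) * k.1 = 1} with hB
  let R : Set (ℝ × Euc d × ℝ) := {q | 0 ≤ q.1 ∧ q = q.1 • p}
  have hRc : IsClosed R :=
    (isClosed_le (f := fun _ => (0 : ℝ)) (g := fun q : ℝ × Euc d × ℝ => q.1)
      (by fun_prop) (by fun_prop)).inter
      (isClosed_eq (f := fun q : ℝ × Euc d × ℝ => q) (g := fun q => q.1 • p)
        (by fun_prop) (by fun_prop))
  have hRconv : Convex ℝ R := by
    rintro q ⟨hq, hq'⟩ q' ⟨hr, hr'⟩ a b ha hb _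
    refine ⟨?_, ?_⟩
    · simp only [Prod.fst_add, Prod.smul_fst, smul_eq_mul]; positivity
    · conv_lhs => rw [hq', hr']
      simp only [Prod.fst_add, Prod.smul_fst, smul_eq_mul]
      module
  have hmem : ∀ a : ℝ, 0 ≤ a → a • p ∈ R := fun a ha => by
    have : (a • p).1 = a := by simp [hp]
    exact ⟨by rwa [this], by rw [this]⟩
  have hdisj : Disjoint (convexHull ℝ B) R := by
    refine Set.disjoint_left.2 fun q hq hq' => hcon q.1 hq'.1 ?_
    rwa [← hq'.2]
  obtain ⟨φ, u, v, h1, huv, h2⟩ := geometric_hahn_banach_compact_closed (convex_convexHull ℝ B)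
    (hf.isCompact_base_epiCone hC).convexHull_of_finiteDimensional hRconv hRc hdisj
  have hv : v < 0 := by simpa using h2 _ (hmem 0 le_rfl)
  have hφp : 0 ≤ φ p := by
    by_contra! hneg
    have := h2 _ (hmem (v / φ p) (div_nonneg_of_nonpos hv.le hneg.le))
    rw [map_smul, smul_eq_mul, div_mul_cancel₀ _ hneg.ne] at this
    exact lt_irrefl _ this
  have hφB : ∀ b ∈ B, φ b < u := fun b hb => h1 b (subset_convexHull ℝ B hb)
  let ψ : Euc d →L[ℝ] ℝ := φ.comp ((ContinuousLinearMap.inr ℝ ℝ (Euc d × ℝ)).comp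
    (ContinuousLinearMap.inl ℝ (Euc d) ℝ))
  obtain ⟨y, hy⟩ := (InnerProductSpace.toDual ℝ (Euc d)).surjective ψ
  set c := φ (1, 0, 0) with hc
  set s := - φ (0, 0, 1) with hs
  have hφ : ∀ x' t', φ (1, x', t') = c + inner ℝ y x' - s * t' := by
    intro x' t'
    have e : ((1 : ℝ), x', t') = (1, 0, 0) + (0, x', 0) + t' • ((0 : ℝ), (0 : Euc d), (1 : ℝ)) := by
      simp
    have e2 : inner ℝ y x' = φ (0, x', 0) := by
      rw [← InnerProductSpace.toDual_apply_apply, hy]; rfl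
    rw [e, map_add, map_add, map_smul, e2, hs, hc, smul_eq_mul]
    ring
  -- The vertical recession direction lies in the base, so the separating hyperplane is not
  -- vertical.
  have hs0 : 0 < s := by
    have := hφB (0, 0, 1) ⟨Or.inr ⟨rfl, rfl, zero_le_one⟩, by simp⟩
    rw [hs]; linarith
  have hmin : ∀ z, ((inner ℝ (s⁻¹ • y) z + s⁻¹ * (c - u) : ℝ) : EReal) ≤ f z := by
    intro z
    by_cases hz : f z = ⊤
    · simp [hz]
    have hz' : (((f z).toReal : ℝ) : EReal) = f z := EReal.coe_toReal hz (hf.ne_bot z)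
    set t' := (f z).toReal
    have hk : ((1 : ℝ), z, t') ∈ epiCone f := Or.inl ⟨one_pos, by simp [hz']⟩
    have hl := le_of_mem_epiCone hC hk
    simp only at hl
    have hl1 : 1 ≤ t' + (C + 1) * 1 := by nlinarith [norm_nonneg z]
    set l := t' + (C + 1) * 1 with hldef
    have hl0 : 0 < l := by linarith
    have hb := hφB (l⁻¹ • (1, z, t')) ⟨smul_mem_epiCone hk (inv_pos.2 hl0), by
      simp only [Set.mem_ofPred_eq, Prod.smul_snd, Prod.smul_fst, smul_eq_mul]
      rw [← mul_left_comm, ← mul_add, ← hldef, inv_mul_cancel₀ hl0.ne']⟩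
    rw [map_smul, smul_eq_mul, inv_mul_lt_iff₀ hl0, hφ] at hb
    rw [← hz']
    norm_cast
    rw [real_inner_smul_left, ← mul_add, inv_mul_le_iff₀ hs0]
    nlinarith
  have hfin := (biconj_le_iff hf.ne_bot hf.exists_lt_top).1 hx _ _ hmin
  rw [real_inner_smul_left, ← mul_add, inv_mul_le_iff₀ hs0] at hfin
  rw [hp, hφ] at hφp
  linarith

/-- The convex envelope of a `1`-coercive lower semicontinuous function is attained as a finite
convex combination of values of the function at points where the two agree. -/
theorem exists_contact_combination (hf : GoodFunction f) {x : Euc d} (hx : biconj f x < ⊤) :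
    ∃ (ι : Type) (_ : Fintype ι) (α : ι → ℝ) (z : ι → Euc d), (∀ i, 0 ≤ α i) ∧ ∑ i, α i = 1 ∧
      ∑ i, α i • z i = x ∧ (∀ i, f (z i) = biconj f (z i) ∧ f (z i) < ⊤) ∧
      ∑ i, α i * (biconj f (z i)).toReal = (biconj f x).toReal := by
  classical
  obtain ⟨C, hC⟩ := hf.exists_norm_le 1
  have hxt := hf.coe_toReal_biconj hx
  set t := (biconj f x).toReal with ht
  obtain ⟨a, ha, hmem⟩ := hf.exists_mem_convexHull_base hC hxt.ge
  obtain ⟨J, _, w, b, hw, hw1, hb, hsum⟩ := mem_convexHull_iff_exists_fintype.1 hmem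
  have e1 : ∑ j, w j * (b j).1 = a := by
    simpa [Prod.fst_sum] using congrArg Prod.fst hsum
  have e2 : ∑ j, w j • (b j).2.1 = a • x := by
    simpa [Prod.fst_sum, Prod.snd_sum] using congrArg (fun q => q.2.1) hsum
  have e3 : ∑ j, w j * (b j).2.2 = a * t := by
    simpa [Prod.snd_sum] using congrArg (fun q => q.2.2) hsum
  -- The functional defining the base equals 1 on the hull and 0 at the origin.
  have ha0 : a ≠ 0 := by
    intro h0
    have h1 : ∑ j, w j * ((b j).2.2 + (C + 1) * (b j).1) = 1 := by
      refine (Finset.sum_congr rfl fun j _ => ?_).trans hw1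
      rw [(hb j).2, mul_one]
    have h2 : ∑ j, w j * ((b j).2.2 + (C + 1) * (b j).1) = a * t + (C + 1) * a := by
      rw [← e3, ← e1, Finset.mul_sum, ← Finset.sum_add_distrib]
      exact Finset.sum_congr rfl fun j _ => by ring
    rw [h1, h0] at h2
    simp at h2
  have hapos : 0 < a := lt_of_le_of_ne ha ha0.symm
  have hb0 : ∀ j, 0 ≤ (b j).1 := fun j => nonneg_of_mem_epiCone (hb j).1
  let β : J → ℝ := fun j => a⁻¹ * (w j * (b j).1)
  have hβ0 : ∀ j, 0 ≤ β j := fun j =>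
    mul_nonneg (inv_nonneg.2 ha) (mul_nonneg (hw j) (hb0 j))
  let ι := {j // β j ≠ 0}
  have hι : ∀ i : ι, 0 < w i.1 ∧ 0 < (b i.1).1 := by
    rintro ⟨j, hj⟩
    simp only [β, ne_eq, mul_eq_zero, not_or] at hj
    exact ⟨lt_of_le_of_ne (hw j) (Ne.symm hj.2.1), lt_of_le_of_ne (hb0 j) (Ne.symm hj.2.2)⟩
  let z : ι → Euc d := fun i => (b i.1).1⁻¹ • (b i.1).2.1
  let τ : ι → ℝ := fun i => (b i.1).1⁻¹ * (b i.1).2.2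
  have hfz : ∀ i, f (z i) ≤ ((τ i : ℝ) : EReal) := by
    intro i
    rcases (hb i.1).1 with h | h
    · exact h.2
    · exact absurd h.1 (hι i).2.ne'
  have hfz' : ∀ i, f (z i) < ⊤ := fun i => (hfz i).trans_lt (EReal.coe_lt_top _)
  -- Terms dropped with `β j = 0` have zero weight or are vertical directions; the latter contribute
  -- nothing to `x` and only a nonnegative amount to the value.
  have hsub : ∀ {M : Type} [AddCommMonoid M] (F : J → M), (∀ j, β j = 0 → F j = 0) →
      ∑ i : ι, F i.1 = ∑ j, F j := by
    intro M _ F hF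
    refine Fintype.sum_of_injective _ Subtype.val_injective _ _ (fun j hj => hF j ?_) fun _ => rfl
    by_contra hne
    exact hj ⟨⟨j, hne⟩, rfl⟩
  have s1 : ∑ i : ι, β i.1 = 1 := by
    rw [hsub β fun _ h => h, ← Finset.mul_sum, e1, inv_mul_cancel₀ ha0]
  have hzero : ∀ j, β j = 0 → w j = 0 ∨ ((b j).2.1 = 0 ∧ 0 ≤ (b j).2.2) := by
    intro j hj
    simp only [β, mul_eq_zero, inv_eq_zero, ha0, false_or] at hj
    rcases hj with h | h
    · exact Or.inl h
    · rcases (hb j).1 with h' | h'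
      · exact absurd h h'.1.ne'
      · exact Or.inr h'.2
  have s2 : ∑ i : ι, β i.1 • z i = x := by
    have h1 : ∀ i : ι, β i.1 • z i = a⁻¹ • w i.1 • (b i.1).2.1 := by
      intro i
      have := (hι i).2.ne'
      simp only [β, z, smul_smul]
      congr 1
      field_simp
    rw [Finset.sum_congr rfl fun i _ => h1 i, hsub (fun j => a⁻¹ • w j • (b j).2.1),
      ← Finset.smul_sum, e2, smul_smul, inv_mul_cancel₀ ha0, one_smul]
    intro j hj
    rcases hzero j hj with h | h <;> simp [h]
  have s3 : ∑ i : ι, β i.1 * τ i ≤ t := by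
    have h1 : ∀ i : ι, β i.1 * τ i = a⁻¹ * (w i.1 * (b i.1).2.2) := by
      intro i
      have := (hι i).2.ne'
      simp only [β, τ]
      field_simp
    let F : J → ℝ := fun j => if β j = 0 then 0 else a⁻¹ * (w j * (b j).2.2)
    have h2 : ∑ i : ι, β i.1 * τ i = ∑ j, F j := by
      rw [← hsub F fun j hj => by simp [F, hj]]
      exact Finset.sum_congr rfl fun i _ => by rw [h1 i]; simp [F, i.2]
    have h3 : t = ∑ j, a⁻¹ * (w j * (b j).2.2) := by
      rw [← Finset.mul_sum, e3, ← mul_assoc, inv_mul_cancel₀ ha0, one_mul]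
    rw [h2, h3]
    refine Finset.sum_le_sum fun j _ => ?_
    by_cases hj : β j = 0
    · simp only [F, hj, if_true]
      rcases hzero j hj with h | h
      · simp [h]
      · exact mul_nonneg (inv_nonneg.2 ha) (mul_nonneg (hw j) h.2)
    · simp [F, hj]
  have hg : ∀ i, biconj f (z i) < ⊤ := fun i => (hf.biconj_le_self _).trans_lt (hfz' i)
  have hg' : ∀ i, (((biconj f (z i)).toReal : ℝ) : EReal) = biconj f (z i) := fun i =>
    hf.coe_toReal_biconj (hg i)
  have hle : ∀ i, (biconj f (z i)).toReal ≤ τ i := fun i => by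
    have := (hf.biconj_le_self (z i)).trans (hfz i)
    rw [← hg' i] at this
    exact_mod_cast this
  have hjen : t ≤ ∑ i : ι, β i.1 * (biconj f (z i)).toReal := by
    have := hf.biconj_sum_le (fun i : ι => hβ0 i.1) s1 (fun i => (hg' i).ge)
    rw [s2, ← hxt] at this
    exact_mod_cast this
  have hup : ∑ i : ι, β i.1 * (biconj f (z i)).toReal ≤ ∑ i : ι, β i.1 * τ i :=
    Finset.sum_le_sum fun i _ => mul_le_mul_of_nonneg_left (hle i) (hβ0 i.1)
  -- Jensen bounds the envelope values below by `t` and the decomposition bounds the heights above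
  -- by `t`; equality termwise forces each point to be a contact point.
  have heq := (Finset.sum_eq_sum_iff_of_le fun (i : ι) _ =>
    mul_le_mul_of_nonneg_left (hle i) (hβ0 i.1)).1 (le_antisymm hup (s3.trans hjen))
  refine ⟨ι, inferInstance, fun i => β i.1, z, fun i => hβ0 i.1, s1, s2, fun i => ⟨?_, hfz' i⟩,
    le_antisymm (hup.trans s3) hjen⟩
  have hτ := mul_left_cancel₀ i.2 (heq i (Finset.mem_univ i))
  refine le_antisymm ?_ (hf.biconj_le_self _)
  rw [← hg' i, hτ]
  exact hfz i

end GoodFunction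

end EpigraphCone

/-! ### Finite sums of extended reals -/

section ERealSums

theorem ereal_coe_sum {ι : Type*} (s : Finset ι) (a : ι → ℝ) :
    ((∑ i ∈ s, a i : ℝ) : EReal) = ∑ i ∈ s, (a i : EReal) := by
  classical
  induction s using Finset.induction_on with
  | empty => simp
  | insert i s hi ih => rw [Finset.sum_insert hi, Finset.sum_insert hi, EReal.coe_add, ih]

theorem ereal_sum_ne_bot {ι : Type*} {s : Finset ι} {a : ι → EReal} (h : ∀ i ∈ s, a i ≠ ⊥) :
    ∑ i ∈ s, a i ≠ ⊥ := by
  classical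
  induction s using Finset.induction_on with
  | empty => simp
  | insert i s hi ih =>
    rw [Finset.sum_insert hi, Ne, EReal.add_eq_bot_iff, not_or]
    exact ⟨h i (Finset.mem_insert_self _ _), ih fun j hj => h j (Finset.mem_insert_of_mem hj)⟩

theorem lt_top_of_ereal_sum_lt_top {ι : Type*} [Fintype ι] {a : ι → EReal} (h : ∀ i, a i ≠ ⊥)
    (hs : ∑ i, a i < ⊤) (i : ι) : a i < ⊤ := by
  classical
  by_contra hi
  rw [not_lt_top_iff] at hi
  rw [← Finset.add_sum_erase _ _ (Finset.mem_univ i), hi,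
    EReal.top_add_of_ne_bot (ereal_sum_ne_bot fun j _ => h j)] at hs
  exact lt_irrefl _ hs

theorem ereal_sum_eq_coe_toReal {ι : Type*} [Fintype ι] {a : ι → EReal} (h : ∀ i, a i ≠ ⊥)
    (h' : ∀ i, a i < ⊤) : ∑ i, a i = ((∑ i, (a i).toReal : ℝ) : EReal) := by
  rw [ereal_coe_sum]
  exact Finset.sum_congr rfl fun i _ => (EReal.coe_toReal (h' i).ne (h i)).symm

end ERealSums

/-! ### Shapley–Folkman -/

/-- The Shapley–Folkman lemma: a sum of convex combinations, one for each of `n` summands, in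
dimension `D`, can be rewritten with at most `n + D` nonzero coefficients, at most `D + 1` of them
for each summand. -/
theorem exists_shapley_folkman {E : Type} [AddCommGroup E] [Module ℝ E] [FiniteDimensional ℝ E]
    {n D : ℕ} (hD : Module.finrank ℝ E = D) {ι : Fin n → Type} [∀ i, Fintype (ι i)]
    (w : ∀ i, ι i → ℝ) (z : ∀ i, ι i → E) (hw : ∀ i k, 0 ≤ w i k) (hw1 : ∀ i, ∑ k, w i k = 1) :
    ∃ (g : ∀ i, Fin (D + 1) → ι i) (lam : Fin n → Fin (D + 1) → ℝ), (∀ i j, 0 ≤ lam i j) ∧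
      (∀ i, ∑ j, lam i j = 1) ∧ ∑ i, ∑ j, lam i j • z i (g i j) = ∑ i, ∑ k, w i k • z i k ∧
      ∑ i, (Finset.univ.filter fun j => lam i j ≠ 0).card ≤ n + D := by
  classical
  -- Tagging each point with the unit vector of its block encodes all n weight sums, in dimension D
  -- + n.
  let φ : E × (Fin n → ℝ) →ₗ[ℝ] ℝ := (∑ i, LinearMap.proj i) ∘ₗ LinearMap.snd ℝ E (Fin n → ℝ)
  obtain ⟨w', h1, -, h3, -, h5⟩ := exists_basic_solution
    (fun p : Σ i, ι i => (z p.1 p.2, (Pi.single p.1 1 : Fin n → ℝ))) 0 φ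
    (fun p => by simp [φ]) (fun p => w p.1 p.2) (fun p => hw p.1 p.2)
  have e1 : ∑ i, ∑ k, w' ⟨i, k⟩ • z i k = ∑ i, ∑ k, w i k • z i k := by
    have := congrArg Prod.fst h3
    simpa only [Prod.fst_sum, Prod.smul_fst, Fintype.sum_sigma] using this
  have e2 : ∀ i, ∑ k, w' ⟨i, k⟩ = 1 := by
    intro i
    have := congrFun (congrArg Prod.snd h3) i
    simp only [Prod.snd_sum, Prod.smul_snd, Fintype.sum_sigma, Finset.sum_apply, Pi.smul_apply,
      smul_eq_mul, Pi.single_apply, mul_ite, mul_one, mul_zero] at this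
    rw [Finset.sum_eq_single i (by intro j _ hj; simp [hj.symm]) (by simp),
      Finset.sum_eq_single i (by intro j _ hj; simp [hj.symm]) (by simp)] at this
    simpa [hw1] using this
  let c : Fin n → ℕ := fun i => (Finset.univ.filter fun k => w' ⟨i, k⟩ ≠ 0).card
  have hc : ∑ i, c i ≤ n + D := by
    have e : ∑ i, c i = (Finset.univ.filter fun p : Σ i, ι i => w' p ≠ 0).card := by
      simp only [c, Finset.card_filter, Fintype.sum_sigma]
    rw [e]
    refine h5.trans ?_
    rw [Module.finrank_prod, hD, Module.finrank_fin_fun, add_comm]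
  have hc1 : ∀ i, 1 ≤ c i := by
    intro i
    obtain ⟨k, -, hk⟩ := Finset.exists_ne_zero_of_sum_ne_zero ((e2 i).trans_ne one_ne_zero)
    exact Finset.card_pos.2 ⟨k, by simpa using hk⟩
  -- Every block uses at least one coefficient, so at most D extra ones remain to be shared.
  have hcD : ∀ i, c i ≤ D + 1 := by
    intro i
    have h6 : ∑ j, c j = ∑ j, (c j - 1) + n := by
      have : ∀ j, c j = (c j - 1) + 1 := fun j => (Nat.sub_add_cancel (hc1 j)).symm
      rw [Finset.sum_congr rfl fun j _ => this j, Finset.sum_add_distrib]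
      simp
    have h7 : c i - 1 ≤ ∑ j, (c j - 1) :=
      Finset.single_le_sum (f := fun j => c j - 1) (fun _ _ => Nat.zero_le _) (Finset.mem_univ i)
    omega
  have hne : ∀ i, Nonempty (ι i) := fun i => by
    obtain ⟨k, -⟩ := Finset.card_pos.1 (hc1 i)
    exact ⟨k⟩
  choose g lam k1 k2 k3 using fun i => exists_reindex (fun k => w' ⟨i, k⟩) (hcD i)
  refine ⟨g, lam, fun i j => ?_, fun i => ?_, ?_, ?_⟩
  · rcases k1 i j with h | h <;> rw [h]
    exact h1 _
  · rw [← e2 i]; exact k3 i ℝ (fun _ a => a) fun _ => rfl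
  · rw [← e1]
    exact Finset.sum_congr rfl fun i _ => k3 i E (fun k a => a • z i k) fun _ => zero_smul _ _
  · rw [Finset.sum_congr rfl fun i _ => k2 i]
    exact hc

theorem finrank_epiSpace (m : ℕ) : Module.finrank ℝ (EpiSpace m) = m + 1 := by
  rw [(WithLp.linearEquiv 2 ℝ (ℝ × EuclideanSpace ℝ (Fin m))).finrank_eq, Module.finrank_prod]
  simp [add_comm]

theorem EpiSpace.ext {m : ℕ} {r r' : EpiSpace m} (h₁ : r.fst = r'.fst) (h₂ : r.snd = r'.snd) :
    r = r' :=
  WithLp.ofLp_injective 2 (Prod.ext h₁ h₂)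

namespace EpiSpace

variable {m : ℕ} {ι : Type*}

theorem fst_sum (s : Finset ι) (r : ι → EpiSpace m) : (∑ i ∈ s, r i).fst = ∑ i ∈ s, (r i).fst :=
  map_sum (WithLp.fstₗ 2 ℝ ℝ (EuclideanSpace ℝ (Fin m))) r s

theorem snd_sum (s : Finset ι) (r : ι → EpiSpace m) : (∑ i ∈ s, r i).snd = ∑ i ∈ s, (r i).snd :=
  map_sum (WithLp.sndₗ 2 ℝ ℝ (EuclideanSpace ℝ (Fin m))) r s

end EpiSpace

/-! ### The relaxed epigraph is convex and closed -/

namespace SepProblem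

variable {n m : ℕ} (P : SepProblem n m)

theorem block_eq (i : Fin n) (x : Euc (P.d i)) : P.block i x = (P.A i).toEuclideanLin x := rfl

theorem block_sum {ι : Type*} (s : Finset ι) (i : Fin n) (w : ι → ℝ) (z : ι → Euc (P.d i)) :
    P.block i (∑ k ∈ s, w k • z k) = ∑ k ∈ s, w k • P.block i (z k) := by
  simp only [block_eq, map_sum, map_smul]

theorem continuous_block (i : Fin n) : Continuous (P.block i) :=
  LinearMap.continuous_of_finiteDimensional (P.A i).toEuclideanLin

theorem continuous_mulA : Continuous P.mulA :=
  continuous_finsetSum _ fun i _ => (P.continuous_block i).comp (continuous_apply i)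

theorem mulA_combo (x y : P.Var) (a b : ℝ) :
    P.mulA (a • x + b • y) = a • P.mulA x + b • P.mulA y := by
  simp only [mulA, Pi.add_apply, Pi.smul_apply, block_eq, map_add, map_smul,
    Finset.sum_add_distrib, Finset.smul_sum]

/-- The projected epigraph of the convex relaxation. -/
def relaxedEpi : Set (EpiSpace m) :=
  {r | ∃ (x : P.Var) (t : Fin n → ℝ), (∀ i, biconj (P.f i) (x i) ≤ t i) ∧ ∑ i, t i ≤ r.fst ∧
    P.Feasible r.snd x}

variable {P}

theorem epiG_subset_relaxedEpi (hf : ∀ i, GoodFunction (P.f i)) : P.epiG ⊆ P.relaxedEpi := by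
  rintro r ⟨x, hx, hfeas⟩
  have hlt := lt_top_of_ereal_sum_lt_top (fun i => (hf i).ne_bot (x i))
    (hx.trans_lt (EReal.coe_lt_top _))
  refine ⟨x, fun i => (P.f i (x i)).toReal, fun i => ?_, ?_, hfeas⟩
  · rw [EReal.coe_toReal (hlt i).ne ((hf i).ne_bot _)]
    exact (hf i).biconj_le_self _
  · rw [ereal_sum_eq_coe_toReal (fun i => (hf i).ne_bot (x i)) hlt] at hx
    exact_mod_cast hx

theorem convex_relaxedEpi (hf : ∀ i, GoodFunction (P.f i)) : Convex ℝ P.relaxedEpi := by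
  rintro r ⟨x, t, h1, h2, h3⟩ r' ⟨x', t', h1', h2', h3'⟩ a b ha hb hab
  refine ⟨a • x + b • x', a • t + b • t', fun i => ?_, ?_, fun k => ?_⟩
  · have := (hf i).biconj_sum_le (w := ![a, b]) (z := ![x i, x' i]) (t := ![t i, t' i])
      (by intro j; fin_cases j <;> simpa) (by simpa) (by intro j; fin_cases j <;> simp [h1, h1'])
    simpa using this
  · simp only [Pi.add_apply, Pi.smul_apply, smul_eq_mul, Finset.sum_add_distrib, ← Finset.mul_sum,
      WithLp.add_fst, WithLp.smul_fst]
    exact add_le_add (mul_le_mul_of_nonneg_left h2 ha) (mul_le_mul_of_nonneg_left h2' hb)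
  · have e : P.mulA (a • x + b • x') - P.b = a • (P.mulA x - P.b) + b • (P.mulA x' - P.b) := by
      rw [mulA_combo, smul_sub, smul_sub]
      have : P.b = a • P.b + b • P.b := by rw [← add_smul, hab, one_smul]
      nth_rewrite 1 [this]
      abel
    rw [e]
    simp only [PiLp.add_apply, PiLp.smul_apply, smul_eq_mul, WithLp.add_snd, WithLp.smul_snd]
    exact add_le_add (mul_le_mul_of_nonneg_left (h3 k) ha) (mul_le_mul_of_nonneg_left (h3' k) hb)

/-- Since ‖x_i‖ ≤ t_i + C_i, all these sums are nonnegative, and a bound on Σ t_i bounds every x_i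
and t_i. A convergent subsequence then supplies the witness for the limit. -/
theorem isClosed_relaxedEpi (hf : ∀ i, GoodFunction (P.f i)) : IsClosed P.relaxedEpi := by
  choose C hC using fun i => (hf i).exists_norm_le_biconj
  refine isClosed_of_closure_subset fun r hr => ?_
  obtain ⟨u, hu, hlim⟩ := mem_closure_iff_seq_limit.1 hr
  choose x t h1 h2 h3 using hu
  have hfst : Filter.Tendsto (fun k => (u k).fst) Filter.atTop (nhds r.fst) :=
    ((WithLp.continuous_fst 2 ℝ (EuclideanSpace ℝ (Fin m))).tendsto r).comp hlim
  have hsnd : Filter.Tendsto (fun k => (u k).snd) Filter.atTop (nhds r.snd) :=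
    ((WithLp.continuous_snd 2 ℝ (EuclideanSpace ℝ (Fin m))).tendsto r).comp hlim
  obtain ⟨R, hR⟩ := hfst.bddAbove_range
  have hlow : ∀ k i, ‖x k i‖ ≤ t k i + C i := fun k i => by
    have := (hC i _).trans (h1 k i)
    norm_cast at this
    linarith
  set D := R + ∑ i, C i
  have hup : ∀ k i, t k i + C i ≤ D := fun k i => by
    have h4 := Finset.single_le_sum (f := fun i => t k i + C i)
      (fun j _ => (norm_nonneg _).trans (hlow k j)) (Finset.mem_univ i)
    rw [Finset.sum_add_distrib] at h4
    have h5 := (h2 k).trans (hR ⟨k, rfl⟩)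
    linarith
  have hball : ∀ k, (x k, t k) ∈ Metric.closedBall (0 : P.Var × (Fin n → ℝ))
      (|D| + ∑ i, |C i|) := by
    intro k
    have hpos : 0 ≤ |D| + ∑ i, |C i| := by positivity
    have hCi : ∀ i, |C i| ≤ ∑ i, |C i| := fun i =>
      Finset.single_le_sum (f := fun i => |C i|) (fun _ _ => abs_nonneg _) (Finset.mem_univ i)
    rw [mem_closedBall_zero_iff]
    refine norm_prod_le_iff.2 ⟨(pi_norm_le_iff_of_nonneg hpos).2 fun i => ?_,
      (pi_norm_le_iff_of_nonneg hpos).2 fun i => ?_⟩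
    · have := (hlow k i).trans (hup k i)
      have := le_abs_self D
      have := (abs_nonneg _).trans (hCi i)
      simp only
      linarith
    · have := (norm_nonneg _).trans (hlow k i)
      have := hup k i
      have := le_abs_self D
      have := hCi i
      have := neg_abs_le (C i)
      have := le_abs_self (C i)
      have := abs_nonneg D
      rw [Real.norm_eq_abs, abs_le]
      constructor <;> simp only <;> linarith
  obtain ⟨⟨x₀, t₀⟩, -, ψ, hψ, hψlim⟩ := tendsto_subseq_of_bounded Metric.isBounded_closedBall hball
  have hx : Filter.Tendsto (fun k => x (ψ k)) Filter.atTop (nhds x₀) :=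
    (continuous_fst.tendsto _).comp hψlim
  have ht : Filter.Tendsto (fun k => t (ψ k)) Filter.atTop (nhds t₀) :=
    (continuous_snd.tendsto _).comp hψlim
  rw [tendsto_pi_nhds] at ht
  refine ⟨x₀, t₀, fun i => ?_, ?_, fun k => ?_⟩
  · have hxi : Filter.Tendsto (fun k => x (ψ k) i) Filter.atTop (nhds (x₀ i)) :=
      tendsto_pi_nhds.1 hx i
    have hpair : Filter.Tendsto (fun k => (x (ψ k) i, t (ψ k) i)) Filter.atTop
        (nhds (x₀ i, t₀ i)) := hxi.prodMk_nhds (ht i)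
    have hmem : (x₀ i, t₀ i) ∈ {p : Euc (P.d i) × ℝ | biconj (P.f i) p.1 ≤ (p.2 : EReal)} :=
      (hf i).isClosed_epi_biconj.mem_of_tendsto hpair
        (Filter.Eventually.of_forall fun k => h1 (ψ k) i)
    exact hmem
  · exact le_of_tendsto_of_tendsto' (tendsto_finsetSum _ fun i _ => ht i)
      (hfst.comp hψ.tendsto_atTop) fun k => h2 (ψ k)
  · have c1 : Continuous fun v : Euc m => v k := by fun_prop
    have c2 : Continuous fun x : P.Var => (P.mulA x - P.b) k :=
      c1.comp (P.continuous_mulA.sub continuous_const)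
    have l1 : Filter.Tendsto (fun l => (P.mulA (x (ψ l)) - P.b) k) Filter.atTop
        (nhds ((P.mulA x₀ - P.b) k)) := (c2.tendsto x₀).comp hx
    have l2 : Filter.Tendsto (fun l => (u (ψ l)).snd k) Filter.atTop (nhds (r.snd k)) :=
      (c1.tendsto _).comp (hsnd.comp hψ.tendsto_atTop)
    exact le_of_tendsto_of_tendsto' l1 l2 fun l => h3 (ψ l) k

theorem epiGHull_subset_relaxedEpi (hf : ∀ i, GoodFunction (P.f i)) :
    P.epiGHull ⊆ P.relaxedEpi :=
  closure_minimal (convexHull_min (epiG_subset_relaxedEpi hf) (convex_relaxedEpi hf))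
    (isClosed_relaxedEpi hf)

end SepProblem

/-! ### Strong duality and existence of an optimal representation -/

namespace SepProblem

variable {n m : ℕ} {P : SepProblem n m}

theorem sumPoint_fst (x : P.Var) : (P.sumPoint x).fst = ∑ i, (biconj (P.f i) (x i)).toReal := by
  rw [sumPoint, EpiSpace.fst_sum]
  rfl

theorem sumPoint_snd (x : P.Var) : (P.sumPoint x).snd = P.mulA x := by
  rw [sumPoint, EpiSpace.snd_sum]
  rfl

theorem zStar_fst (x : P.Var) (w : Euc m) : (P.zStar x w).fst = (P.sumPoint x).fst :=
  add_zero (P.sumPoint x).fst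

theorem zStar_snd (x : P.Var) (w : Euc m) : (P.zStar x w).snd = P.mulA x + (w - P.b) := by
  rw [← sumPoint_snd]
  rfl

theorem IsRelaxedOptimal.coe_fst_eq (hf : ∀ i, GoodFunction (P.f i)) {x : P.Var}
    (hx : P.IsRelaxedOptimal x) : (((P.sumPoint x).fst : ℝ) : EReal) = P.hCoP 0 := by
  rw [← hx.2.2, sumPoint_fst, ereal_sum_eq_coe_toReal (fun i => (hf i).biconj_ne_bot _) hx.2.1]

theorem hCoP_le_of_mem_relaxedEpi {r : EpiSpace m} (hr : r ∈ P.relaxedEpi) :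
    P.hCoP r.snd ≤ (r.fst : EReal) := by
  obtain ⟨x, t, h1, h2, h3⟩ := hr
  refine (iInf₂_le x h3).trans ((Finset.sum_le_sum fun i _ => h1 i).trans ?_)
  rw [← ereal_coe_sum]
  exact_mod_cast h2

/-- The slice of the closed relaxed epigraph over zero perturbation is closed and bounded below, so
it contains its infimum. -/
theorem exists_isRelaxedOptimal (hf : ∀ i, GoodFunction (P.f i)) (h : P.hCoP 0 < ⊤) :
    ∃ x, P.IsRelaxedOptimal x := by
  let T : Set ℝ := {a | (WithLp.toLp 2 (a, (0 : Euc m)) : EpiSpace m) ∈ P.relaxedEpi}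
  have hTc : IsClosed T := (isClosed_relaxedEpi hf).preimage
    ((WithLp.prod_continuous_toLp 2 ℝ (Euc m)).comp (continuous_id.prodMk continuous_const))
  have hmemT : ∀ x : P.Var, P.Feasible 0 x → (∀ i, biconj (P.f i) (x i) < ⊤) →
      ∑ i, (biconj (P.f i) (x i)).toReal ∈ T := fun x hx hx' =>
    ⟨x, fun i => (biconj (P.f i) (x i)).toReal, fun i => ((hf i).coe_toReal_biconj (hx' i)).ge,
      le_rfl, hx⟩
  have hTne : T.Nonempty := by
    simp only [hCoP, iInf_lt_iff] at h
    obtain ⟨x, hx, hlt⟩ := h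
    exact ⟨_, hmemT x hx (lt_top_of_ereal_sum_lt_top (fun i => (hf i).biconj_ne_bot _) hlt)⟩
  choose C hC using fun i => (hf i).exists_norm_le_biconj
  have hTb : BddBelow T := by
    refine ⟨∑ i, -C i, ?_⟩
    rintro a ⟨x, t, h1, h2, -⟩
    refine le_trans (Finset.sum_le_sum fun i _ => ?_) h2
    have := (hC i _).trans (h1 i)
    norm_cast at this
    linarith [norm_nonneg (x i)]
  obtain ⟨x, t, h1, h2, h3⟩ := hTc.csInf_mem hTne hTb
  have hlt : ∀ i, biconj (P.f i) (x i) < ⊤ := fun i => (h1 i).trans_lt (EReal.coe_lt_top _)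
  refine ⟨x, h3, hlt, le_antisymm (le_iInf₂ fun y hy => ?_) (iInf₂_le x h3)⟩
  by_cases hy' : ∑ i, biconj (P.f i) (y i) < ⊤
  · have hlt' := lt_top_of_ereal_sum_lt_top (fun i => (hf i).biconj_ne_bot (y i)) hy'
    calc ∑ i, biconj (P.f i) (x i) ≤ ∑ i, (t i : EReal) := Finset.sum_le_sum fun i _ => h1 i
      _ = ((∑ i, t i : ℝ) : EReal) := (ereal_coe_sum _ _).symm
      _ ≤ ((∑ i, (biconj (P.f i) (y i)).toReal : ℝ) : EReal) := by
          exact_mod_cast h2.trans (csInf_le hTb (hmemT y hy hlt'))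
      _ = ∑ i, biconj (P.f i) (y i) :=
          (ereal_sum_eq_coe_toReal (fun i => (hf i).biconj_ne_bot _) hlt').symm
  · rw [not_lt_top_iff.1 hy']
    exact le_top

/-- Strong duality: the supremum of the dual function is the optimal value of the relaxation. -/
theorem exists_le_dualFun (hf : ∀ i, GoodFunction (P.f i)) {x : P.Var}
    (hx : P.IsRelaxedOptimal x) {t : ℝ} (ht : (t : EReal) < P.hCoP 0) :
    ∃ l : Euc m, (∀ k, 0 ≤ l k) ∧ (t : EReal) ≤ P.dualFun l := by
  set v := (P.sumPoint x).fst with hv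
  have hvP : (v : EReal) = P.hCoP 0 := hx.coe_fst_eq hf
  have hnot : (WithLp.toLp 2 (t, (0 : Euc m)) : EpiSpace m) ∉ P.relaxedEpi := fun hmem =>
    (hCoP_le_of_mem_relaxedEpi hmem).not_gt ht
  have hmem : ∀ (a : ℝ) (b : Euc m), 0 ≤ a → (∀ k, 0 ≤ b k) →
      (WithLp.toLp 2 (v + a, b) : EpiSpace m) ∈ P.relaxedEpi := fun a b ha hb =>
    ⟨x, fun i => (biconj (P.f i) (x i)).toReal,
      fun i => ((hf i).coe_toReal_biconj (hx.2.1 i)).ge,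
      by rw [hv, sumPoint_fst]; exact le_add_of_nonneg_right ha,
      fun k => (hx.1 k).trans (hb k)⟩
  obtain ⟨φ, u, h1, h2⟩ := geometric_hahn_banach_point_closed (convex_relaxedEpi hf)
    (isClosed_relaxedEpi hf) hnot
  obtain ⟨q, hq⟩ := (InnerProductSpace.toDual ℝ (EpiSpace m)).surjective φ
  have hφ : ∀ r : EpiSpace m, φ r = q.fst * r.fst + inner ℝ q.snd r.snd := fun r => by
    rw [← hq, InnerProductSpace.toDual_apply_apply, WithLp.prod_inner_apply]
    simp [mul_comm]
  have h3 : ∀ (a : ℝ) (b : Euc m), 0 ≤ a → (∀ k, 0 ≤ b k) →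
      u < q.fst * (v + a) + inner ℝ q.snd b := fun a b ha hb => by
    simpa [hφ] using h2 _ (hmem a b ha hb)
  have h1' : q.fst * t < u := by simpa [hφ] using h1
  have htv : t < v := by rw [← hvP] at ht; exact_mod_cast ht
  -- No constraint qualification is needed: (t, 0) and (v, 0) with t < v lie on opposite sides, so
  -- the hyperplane is not vertical.
  have hs : 0 < q.fst := by
    have := h3 0 0 le_rfl fun _ => le_rfl
    simp only [add_zero, inner_zero_right] at this
    by_contra! hneg
    nlinarith
  have hl : ∀ k, 0 ≤ q.snd k := by
    intro k
    by_contra! hneg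
    have h4 := h3 0 0 le_rfl fun _ => le_rfl
    simp only [add_zero, inner_zero_right] at h4
    -- The relaxed epigraph is closed under enlarging the perturbation; this length makes a negative
    -- multiplier yield u < u.
    have h5 := h3 0 (EuclideanSpace.single k ((u - q.fst * v) / q.snd k)) le_rfl fun j => by
      have : 0 ≤ (u - q.fst * v) / q.snd k :=
        div_nonneg_of_nonpos (by linarith) hneg.le
      simp only [PiLp.single_apply]
      split_ifs
      · exact this
      · exact le_rfl
    rw [EuclideanSpace.inner_single_right] at h5
    simp only [conj_trivial, add_zero] at h5
    rw [div_mul_cancel₀ _ hneg.ne] at h5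
    linarith
  refine ⟨q.fst⁻¹ • q.snd, fun k => mul_nonneg (inv_nonneg.2 hs.le) (hl k),
    le_iInf₂ fun r hr => ?_⟩
  have h6 := h2 r (epiGHull_subset_relaxedEpi hf hr)
  rw [hφ] at h6
  norm_cast
  rw [real_inner_smul_left, ← mul_le_mul_iff_right₀ hs, mul_add, ← mul_assoc,
    mul_inv_cancel₀ hs.ne', one_mul]
  linarith

/-- The dual value is only approached by multipliers, as a maximizer need not exist; one that exists
dominates them all. -/
theorem IsDualOptimal.hCoP_le (hf : ∀ i, GoodFunction (P.f i)) {x : P.Var}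
    (hx : P.IsRelaxedOptimal x) {l : Euc m} (hl : P.IsDualOptimal l) :
    P.hCoP 0 ≤ P.dualFun l := by
  by_contra! hcon
  obtain ⟨t, ht1, ht2⟩ := EReal.lt_iff_exists_real_btwn.1 hcon
  obtain ⟨l', hl', hle⟩ := exists_le_dualFun hf hx ht2
  exact (hle.trans (hl.2 l' hl')).not_gt ht1

open scoped Pointwise in
-- The hull of a Minkowski sum is the sum of the hulls, and a sum of contact points shifted by −b is
-- in `epiG` because `f` equals its envelope there.
theorem add_sum_mem_convexHull_epiG
    {ι : Fin n → Type} [∀ i, Fintype (ι i)] {lam : ∀ i, ι i → ℝ} {z : ∀ i, ι i → EpiSpace m}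
    (h0 : ∀ i j, 0 ≤ lam i j) (h1 : ∀ i, ∑ j, lam i j = 1) (hz : ∀ i j, z i j ∈ P.contactF i) :
    ∑ i, ∑ j, lam i j • z i j + WithLp.toLp 2 ((0 : ℝ), -P.b) ∈ convexHull ℝ P.epiG := by
  have hsum : ∑ i, ∑ j, lam i j • z i j ∈ convexHull ℝ (∑ i, P.contactF i) := by
    rw [convexHull_sum]
    exact Set.finsetSum_mem_finsetSum _ _ _ fun i _ =>
      mem_convexHull_of_exists_fintype (lam i) (z i) (h0 i) (h1 i) (hz i) rfl
  have hsub : ∑ i, P.contactF i ⊆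
      (fun r => r + WithLp.toLp 2 ((0 : ℝ), -P.b)) ⁻¹' convexHull ℝ P.epiG := by
    intro r hr
    obtain ⟨g, hg, rfl⟩ := (Set.mem_finsetSum _ _ _).1 hr
    refine subset_convexHull ℝ _ ?_
    choose y hy1 hy2 hy3 using fun i => hg (Finset.mem_univ i)
    refine ⟨y, ?_, fun k => ?_⟩
    · rw [WithLp.add_fst, EpiSpace.fst_sum, WithLp.toLp_fst, add_zero, ereal_coe_sum]
      exact Finset.sum_le_sum fun i _ => by rw [hy1, hy2]
    · rw [WithLp.add_snd, EpiSpace.snd_sum, WithLp.toLp_snd, ← sub_eq_add_neg]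
      simp only [mulA, hy3]
      exact le_rfl
  exact convexHull_min hsub ((convex_convexHull ℝ _).translate_preimage_left _) hsum

theorem exists_isOptimalRepresentation (hf : ∀ i, GoodFunction (P.f i)) (h : P.hCoP 0 < ⊤) :
    ∃ x w lam z, P.IsOptimalRepresentation x w lam z := by
  obtain ⟨x, hx⟩ := exists_isRelaxedOptimal hf h
  choose ι hι α y a1 a2 a3 a4 a5 using fun i => (hf i).exists_contact_combination (hx.2.1 i)
  let z : ∀ i, ι i → EpiSpace m := fun i k =>
    WithLp.toLp 2 ((biconj (P.f i) (y i k)).toReal, P.block i (y i k))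
  have hz : ∀ i k, z i k ∈ P.contactF i := fun i k =>
    ⟨y i k, (hf i).coe_toReal_biconj ((a4 i k).1 ▸ (a4 i k).2), (a4 i k).1, rfl⟩
  have hsum : ∑ i, ∑ k, α i k • z i k = P.sumPoint x := by
    refine Finset.sum_congr rfl fun i _ => EpiSpace.ext ?_ ?_
    · rw [EpiSpace.fst_sum, WithLp.toLp_fst, ← a5 i]
      rfl
    · rw [EpiSpace.snd_sum, WithLp.toLp_snd]
      conv_rhs => rw [← a3 i, block_sum]
      rfl
  obtain ⟨g, lam, b1, b2, b3, b4⟩ := exists_shapley_folkman (finrank_epiSpace m) α z a1 a2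
  have hzs : P.zStar x 0 = P.sumPoint x + WithLp.toLp 2 ((0 : ℝ), -P.b) := by
    rw [zStar, zero_sub]
  have hmem : P.zStar x 0 ∈ P.epiGHull := by
    rw [hzs, ← hsum]
    exact subset_closure (add_sum_mem_convexHull_epiG a1 a2 hz)
  refine ⟨x, 0, lam, fun i j => z i (g i j), hx, fun k => le_rfl, ⟨hmem, fun l hl => ?_⟩,
    ⟨b1, b2, fun i j => hz i _⟩, ?_, b4⟩
  · refine le_antisymm ?_ (iInf₂_le _ hmem)
    refine le_trans ?_ (hl.hCoP_le hf hx)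
    rw [← hx.coe_fst_eq hf]
    norm_cast
    rw [zStar_fst, zStar_snd, zero_sub, ← sub_eq_add_neg]
    -- Weak duality: nonnegative multipliers against a feasible residual.
    have : inner ℝ l (P.mulA x - P.b) ≤ 0 := by
      rw [PiLp.inner_apply]
      refine Finset.sum_nonpos fun k _ => ?_
      have h1 := hl.1 k
      have h2 : (P.mulA x - P.b) k ≤ 0 := hx.1 k
      simp only [RCLike.inner_apply, conj_trivial]
      exact mul_nonpos_of_nonpos_of_nonneg h2 h1
    linarith
  · rw [b3, hsum, zStar]

end SepProblem

/-! ### From sparse errors to the duality gap -/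

/-- `rhoK` tests only d + 1 points, while the combination may have more. The reduction to a basic
solution keeps the barycentre, stays within the old support and does not raise the averaged value,
so the bound transfers. -/
theorem GoodFunction.le_add_rhoK {d : ℕ} {f : Euc d → EReal} (hf : GoodFunction f)
    {J : Type*} [Fintype J] {w : J → ℝ} {z : J → Euc d} (hw : ∀ j, 0 ≤ w j)
    (hw1 : ∑ j, w j = 1) (hz : ∀ j, f (z j) < ⊤) {k : ℕ}
    (hk : (Finset.univ.filter fun j => w j ≠ 0).card ≤ k) :
    f (∑ j, w j • z j) ≤ ((∑ j, w j * (f (z j)).toReal : ℝ) : EReal) + rhoK f k := by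
  classical
  obtain ⟨w', h1, h2, h3, h4, h5⟩ := exists_basic_solution (fun j => (z j, (1 : ℝ)))
    (fun j => (f (z j)).toReal) (LinearMap.snd ℝ (Euc d) ℝ) (fun _ => rfl) w hw
  have hfin : Module.finrank ℝ (Euc d × ℝ) = d + 1 := by simp
  rw [hfin] at h5
  have e1 : ∑ j, w' j • z j = ∑ j, w j • z j := by
    simpa [Prod.fst_sum] using congrArg Prod.fst h3
  have e2 : ∑ j, w' j = 1 := by
    simpa [Prod.snd_sum, hw1] using congrArg Prod.snd h3
  have hcard : (Finset.univ.filter fun j => w' j ≠ 0).card ≤ k := by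
    refine (Finset.card_le_card fun j hj => ?_).trans hk
    simp only [Finset.mem_filter, Finset.mem_univ, true_and] at hj ⊢
    exact fun h => hj (h2 j h)
  have : Nonempty J := by
    by_contra hcon
    rw [not_nonempty_iff] at hcon
    simp at hw1
  obtain ⟨g, α, k1, k2, k3⟩ := exists_reindex w' h5
  have hα : ∀ i, 0 ≤ α i := fun i => by
    rcases k1 i with h | h <;> rw [h]
    exact h1 _
  have s1 : ∑ i, α i = 1 := by rw [← e2]; exact k3 ℝ (fun _ a => a) fun _ => rfl
  have s2 : ∑ i, α i • z (g i) = ∑ j, w j • z j := by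
    rw [← e1]; exact k3 (Euc d) (fun j a => a • z j) fun _ => zero_smul _ _
  have s3 : ∑ i, α i * (f (z (g i))).toReal = ∑ j, w' j * (f (z j)).toReal :=
    k3 ℝ (fun j a => a * (f (z j)).toReal) fun _ => zero_mul _
  have hsum : ∑ i, (α i : EReal) * f (z (g i)) =
      ((∑ j, w' j * (f (z j)).toReal : ℝ) : EReal) := by
    rw [← s3, ereal_coe_sum]
    refine Finset.sum_congr rfl fun i _ => ?_
    rw [EReal.coe_mul, EReal.coe_toReal (hz _).ne (hf.ne_bot _)]
  have hrho : f (∑ i, α i • z (g i)) - ∑ i, (α i : EReal) * f (z (g i)) ≤ rhoK f k :=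
    le_iSup₂_of_le (f := fun (x : Fin (d + 1) → Euc d) (α : Fin (d + 1) → ℝ) =>
      ⨆ (_ : (∀ j, f (x j) < ⊤) ∧ (∀ j, 0 ≤ α j) ∧ ∑ j, α j = 1 ∧
        (Finset.univ.filter fun j => α j ≠ 0).card ≤ k),
        f (∑ j, α j • x j) - ∑ j, (α j : EReal) * f (x j)) (fun i => z (g i)) α
      (le_iSup_of_le ⟨fun i => hz _, hα, s1, k2.trans_le hcard⟩ le_rfl)
  rw [hsum, s2, EReal.sub_le_iff_le_add (Or.inl (EReal.coe_ne_bot _))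
    (Or.inl (EReal.coe_ne_top _)), add_comm] at hrho
  refine hrho.trans (add_le_add_left ?_ _)
  exact_mod_cast h4

namespace SepProblem

variable {n m : ℕ} {P : SepProblem n m}

theorem IsSparseError.gapBound (hf : ∀ i, GoodFunction (P.f i)) {x : P.Var} {w : Euc m}
    (hx : P.IsRelaxedOptimal x) {s : ℝ} {u : EpiSpace m}
    (hu : P.IsSparseError (P.zStar x w) w s u) : P.GapBound s u := by
  classical
  refine ⟨iInf₂_mono fun x _ => Finset.sum_le_sum fun i _ => (hf i).biconj_le_self _, ?_⟩
  obtain ⟨μ, y, ⟨h0, h1, hy⟩, hs, hu⟩ := hu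
  choose p hp1 hp2 hp3 using hy
  have hfp : ∀ i j, P.f i (p i j) = ((y i j).fst : EReal) := fun i j => (hp2 i j).trans (hp1 i j).symm
  let β : Fin n → ℕ := fun i => (Finset.univ.filter fun j => μ i j ≠ 0).card
  have hu1 : ∑ i, ∑ j, μ i j * (y i j).fst = (P.sumPoint x).fst + u.fst := by
    have : u.fst = (∑ i, ∑ j, μ i j • y i j).fst + 0 - (P.zStar x w).fst := by rw [hu]; rfl
    rw [zStar_fst, EpiSpace.fst_sum] at this
    simp only [EpiSpace.fst_sum, WithLp.smul_fst, smul_eq_mul] at this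
    linarith
  have hu2 : P.mulA (fun i => ∑ j, μ i j • p i j) = P.mulA x + u.snd := by
    have h2 : u.snd = (∑ i, ∑ j, μ i j • y i j).snd + (w - P.b) - (P.zStar x w).snd := by
      rw [hu]; rfl
    rw [zStar_snd, EpiSpace.snd_sum] at h2
    simp only [EpiSpace.snd_sum, WithLp.smul_snd, hp3] at h2
    simp only [mulA, block_sum] at h2 ⊢
    rw [h2]
    abel
  -- The averaged point has residual (Ax − b) + u₂, and x is feasible; `w` has cancelled.
  have hfeas : P.Feasible u.snd (fun i => ∑ j, μ i j • p i j) := by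
    intro k
    have h3 : (P.mulA x - P.b) k ≤ 0 := hx.1 k
    have e : P.mulA (fun i => ∑ j, μ i j • p i j) - P.b = (P.mulA x - P.b) + u.snd := by
      rw [hu2]; abel
    rw [e, PiLp.add_apply]
    linarith
  have hβ : (∀ i, 1 ≤ β i ∧ β i ≤ m + 2) ∧ ((∑ i, β i : ℕ) : ℝ) ≤ s := by
    refine ⟨fun i => ⟨?_, ?_⟩, hs⟩
    · obtain ⟨j, -, hj⟩ := Finset.exists_ne_zero_of_sum_ne_zero ((h1 i).trans_ne one_ne_zero)
      exact Finset.card_pos.2 ⟨j, by simpa using hj⟩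
    · exact (Finset.card_le_univ _).trans (by simp)
  have hrho : ∑ i, rhoK (P.f i) (β i) ≤ P.maxRho s :=
    le_iSup₂ (f := fun (β : Fin n → ℕ) (_ : (∀ i, 1 ≤ β i ∧ β i ≤ m + 2) ∧
      ((∑ i, β i : ℕ) : ℝ) ≤ s) => ∑ i, rhoK (P.f i) (β i)) β hβ
  calc P.hP u.snd ≤ ∑ i, P.f i (∑ j, μ i j • p i j) := iInf₂_le _ hfeas
    _ ≤ ∑ i, (((∑ j, μ i j * (y i j).fst : ℝ) : EReal) + rhoK (P.f i) (β i)) := by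
        refine Finset.sum_le_sum fun i _ => ?_
        have := (hf i).le_add_rhoK (h0 i) (h1 i) (z := p i)
          (fun j => by rw [hfp]; exact EReal.coe_lt_top _) (k := β i) le_rfl
        simpa only [hfp, EReal.toReal_coe] using this
    _ = (((P.sumPoint x).fst + u.fst : ℝ) : EReal) + ∑ i, rhoK (P.f i) (β i) := by
        rw [Finset.sum_add_distrib, ← ereal_coe_sum, hu1]
    _ ≤ (((P.sumPoint x).fst + |u.fst| : ℝ) : EReal) + P.maxRho s := by
        refine add_le_add ?_ hrho
        exact_mod_cast add_le_add_right (le_abs_self _) _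
    _ = P.hCoP 0 + (((|u.fst| : ℝ) : EReal) + P.maxRho s) := by
        rw [EReal.coe_add, hx.coe_fst_eq hf, add_assoc]

end SepProblem

/-! ### Sparse approximation by sampling -/

/-- Maurey's lemma: independent choices from several convex combinations can be made so that the
squared error of their sum is at most the sum of the second moments. -/
theorem exists_choice_norm_sq_le {E T J : Type*} [NormedAddCommGroup E] [InnerProductSpace ℝ E]
    [Fintype J] (p : T → J → ℝ) (X : T → J → E) (hp : ∀ t j, 0 ≤ p t j)
    (hp1 : ∀ t, ∑ j, p t j = 1) (S : Finset T) :
    ∃ c : T → J, ‖∑ t ∈ S, (X t (c t) - ∑ j, p t j • X t j)‖ ^ 2 ≤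
      ∑ t ∈ S, ∑ j, p t j * ‖X t j‖ ^ 2 := by
  classical
  induction S using Finset.induction_on with
  | empty =>
    have : ∀ t, Nonempty J := fun t => by
      by_contra hcon
      rw [not_nonempty_iff] at hcon
      simpa using hp1 t
    exact ⟨fun t => (this t).some, by simp⟩
  | insert t S ht ih =>
    obtain ⟨c, hc⟩ := ih
    set r := ∑ t ∈ S, (X t (c t) - ∑ j, p t j • X t j) with hr
    set e := ∑ j, p t j • X t j with he
    set B := ‖r‖ ^ 2 + ∑ j, p t j * ‖X t j‖ ^ 2 with hB
    have hexp : ∀ j, ‖X t j - e + r‖ ^ 2 =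
        ‖X t j‖ ^ 2 + 2 * inner ℝ (X t j) (r - e) + ‖r - e‖ ^ 2 := fun j => by
      rw [← norm_add_sq_real]
      congr 2
      abel
    have hlin : ∑ j, p t j * inner ℝ (X t j) (r - e) = inner ℝ e (r - e) := by
      simp only [he, sum_inner, real_inner_smul_left]
    -- The cross term averages to zero since `X t j - e` has mean zero, so some `j` does no worse
    -- than the average: a derandomized choice, one index at a time.
    have havg : ∑ j, p t j * ‖X t j - e + r‖ ^ 2 ≤ B := by
      have h1 : ∑ j, p t j * ‖X t j - e + r‖ ^ 2 =
          ∑ j, p t j * ‖X t j‖ ^ 2 + 2 * inner ℝ e (r - e) + ‖r - e‖ ^ 2 := by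
        simp only [hexp, mul_add, Finset.sum_add_distrib, ← Finset.sum_mul, hp1, one_mul]
        rw [← hlin, Finset.mul_sum]
        congr 2
        exact Finset.sum_congr rfl fun j _ => by ring
      have h2 : 2 * inner ℝ e (r - e) + ‖r - e‖ ^ 2 = ‖r‖ ^ 2 - ‖e‖ ^ 2 := by
        rw [inner_sub_right, real_inner_self_eq_norm_sq, norm_sub_sq_real, real_inner_comm]
        ring
      rw [h1, hB]
      nlinarith [sq_nonneg ‖e‖]
    obtain ⟨j, hj⟩ : ∃ j, ‖X t j - e + r‖ ^ 2 ≤ B := by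
      by_contra! hcon
      obtain ⟨j₀, -, hj₀⟩ := Finset.exists_ne_zero_of_sum_ne_zero ((hp1 t).trans_ne one_ne_zero)
      have h3 : ∑ j, p t j * B < ∑ j, p t j * ‖X t j - e + r‖ ^ 2 :=
        Finset.sum_lt_sum (fun j _ => mul_le_mul_of_nonneg_left (hcon j).le (hp t j))
          ⟨j₀, Finset.mem_univ _,
            mul_lt_mul_of_pos_left (hcon j₀) (lt_of_le_of_ne (hp t j₀) hj₀.symm)⟩
      rw [← Finset.sum_mul, hp1, one_mul] at h3
      exact havg.not_gt h3
    refine ⟨Function.update c t j, ?_⟩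
    rw [Finset.sum_insert ht, Finset.sum_insert ht, Function.update_self]
    have h4 : ∑ t' ∈ S, (X t' (Function.update c t j t') - ∑ j, p t' j • X t' j) = r :=
      Finset.sum_congr rfl fun t' ht' => by
        rw [Function.update_of_ne (ne_of_mem_of_not_mem ht' ht)]
    rw [h4]
    linarith

/-- A sum of convex combinations can be approximated by keeping those combinations that are
concentrated on one point, and replacing each of the others by an average of `q` of its points. -/
theorem exists_sparse_approximation {E I J : Type*} [NormedAddCommGroup E]
    [InnerProductSpace ℝ E] [Fintype I] [Fintype J] [DecidableEq I] {lam : I → J → ℝ}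
    {z : I → J → E} (h0 : ∀ i j, 0 ≤ lam i j) (h1 : ∀ i, ∑ j, lam i j = 1) (S : Finset I)
    {q : ℕ} (hq : 0 < q) :
    ∃ μ : I → J → ℝ, (∀ i j, 0 ≤ μ i j) ∧ (∀ i, ∑ j, μ i j = 1) ∧
      (∀ i ∈ S, (Finset.univ.filter fun j => μ i j ≠ 0).card ≤ q) ∧ (∀ i ∉ S, μ i = lam i) ∧
      ‖∑ i, ∑ j, μ i j • z i j - ∑ i, ∑ j, lam i j • z i j‖ ^ 2 ≤
        (∑ i ∈ S, ∑ j, lam i j * ‖z i j‖ ^ 2) / q := by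
  classical
  have hq0 : (q : ℝ) ≠ 0 := by positivity
  obtain ⟨c, hc⟩ := exists_choice_norm_sq_le (fun (t : I × Fin q) j => lam t.1 j)
    (fun t j => (q : ℝ)⁻¹ • z t.1 j) (fun t j => h0 _ _) (fun t => h1 _) (S ×ˢ Finset.univ)
  -- Empirical frequencies of `q` draws per block: at most `q` are nonzero, and the scaling 1/q
  -- divides the second moment by `q` overall.
  let ν : I → J → ℝ := fun i j => ∑ t : Fin q, if c (i, t) = j then (q : ℝ)⁻¹ else 0
  have hν1 : ∀ i, ∑ j, ν i j = 1 := fun i => by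
    simp only [ν]
    rw [Finset.sum_comm]
    simp [hq0]
  have hνz : ∀ i, ∑ j, ν i j • z i j = ∑ t : Fin q, (q : ℝ)⁻¹ • z i (c (i, t)) := fun i => by
    simp only [ν, Finset.sum_smul]
    rw [Finset.sum_comm]
    simp [ite_smul]
  refine ⟨fun i => if i ∈ S then ν i else lam i, fun i j => ?_, fun i => ?_, fun i hi => ?_,
    fun i hi => if_neg hi, ?_⟩
  · dsimp only
    split_ifs
    · exact Finset.sum_nonneg fun t _ => by split_ifs <;> positivity
    · exact h0 i j
  · dsimp only
    split_ifs
    · exact hν1 i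
    · exact h1 i
  · simp only [hi, if_true]
    have hsub : (Finset.univ.filter fun j => ν i j ≠ 0) ⊆
        Finset.univ.image fun t : Fin q => c (i, t) := by
      intro j hj
      simp only [Finset.mem_filter, Finset.mem_univ, true_and] at hj
      obtain ⟨t, -, ht⟩ := Finset.exists_ne_zero_of_sum_ne_zero hj
      simp only [ne_eq, ite_eq_right_iff, Classical.not_imp] at ht
      exact Finset.mem_image.2 ⟨t, Finset.mem_univ _, ht.1⟩
    exact (Finset.card_le_card hsub).trans (Finset.card_image_le.trans (by simp))
  · have e1 : ∑ i, ∑ j, (if i ∈ S then ν i else lam i) j • z i j - ∑ i, ∑ j, lam i j • z i j =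
        ∑ t ∈ S ×ˢ (Finset.univ : Finset (Fin q)),
          ((q : ℝ)⁻¹ • z t.1 (c t) - ∑ j, lam t.1 j • (q : ℝ)⁻¹ • z t.1 j) := by
      rw [Finset.sum_product, ← Finset.sum_sub_distrib,
        ← Finset.sum_subset (Finset.subset_univ S)]
      · refine Finset.sum_congr rfl fun i hi => ?_
        simp only [hi, if_true, hνz, Finset.sum_sub_distrib]
        congr 1
        simp only [Finset.sum_const, Finset.card_univ, Fintype.card_fin, ← Nat.cast_smul_eq_nsmul ℝ,
          Finset.smul_sum]
        refine Finset.sum_congr rfl fun j _ => ?_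
        rw [smul_comm (lam i j), smul_smul, mul_inv_cancel₀ hq0, one_smul]
      · intro i _ hi
        simp [hi]
    rw [e1]
    refine hc.trans (le_of_eq ?_)
    rw [Finset.sum_product, Finset.sum_div]
    refine Finset.sum_congr rfl fun i _ => ?_
    simp only [Finset.sum_const, Finset.card_univ, Fintype.card_fin, nsmul_eq_mul, Finset.mul_sum,
      Finset.sum_div, norm_smul, norm_inv, RCLike.norm_natCast]
    refine Finset.sum_congr rfl fun j _ => ?_
    field_simp

/-! ### Counting coefficients and the error bound -/

section Counting

variable {J : Type*} [Fintype J] {a : J → ℝ}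

theorem card_support_eq_one (h0 : ∀ j, 0 ≤ a j) (h1 : ∑ j, a j = 1) (h : ∃ j, a j = 1) :
    (Finset.univ.filter fun j => a j ≠ 0).card = 1 := by
  classical
  obtain ⟨j, hj⟩ := h
  rw [← Finset.add_sum_erase _ _ (Finset.mem_univ j), hj, add_eq_left,
    Finset.sum_eq_zero_iff_of_nonneg fun _ _ => h0 _] at h1
  refine Finset.card_eq_one.2 ⟨j, Finset.ext fun k => ?_⟩
  simp only [Finset.mem_filter, Finset.mem_univ, true_and, Finset.mem_singleton]
  constructor
  · intro hk
    by_contra hne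
    exact hk (h1 k (Finset.mem_erase.2 ⟨hne, Finset.mem_univ _⟩))
  · rintro rfl
    simp [hj]

theorem two_le_card_support (h1 : ∑ j, a j = 1) (h : ∀ j, a j ≠ 1) :
    2 ≤ (Finset.univ.filter fun j => a j ≠ 0).card := by
  classical
  by_contra! hlt
  rw [← Finset.sum_filter_ne_zero] at h1
  obtain hc | hc : (Finset.univ.filter fun j => a j ≠ 0).card = 0 ∨
      (Finset.univ.filter fun j => a j ≠ 0).card = 1 := by omega
  · rw [Finset.card_eq_zero.1 hc] at h1
    simp at h1
  · obtain ⟨j, hj⟩ := Finset.card_eq_one.1 hc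
    rw [hj, Finset.sum_singleton] at h1
    exact h j h1

end Counting

/-- Multiplying by p ≤ N·Rl gives N²·Rv·(Rl·Mv), which AM–GM bounds by N²/4 times the squared sum.
With N ≤ 4m, N²/4 is at most 4m², which is at most 2mpqγ² by the choice of b. -/
theorem variance_le {Rv Rl Mv N p q m b γ : ℝ} (hRv : 0 ≤ Rv) (hMv : 0 ≤ Mv) (hN : 0 ≤ N)
    (hp : 0 < p) (hq : 0 < q) (hm : 1 ≤ m) (hpN : p ≤ N * Rl) (hNm : N ≤ 4 * m)
    (hbpq : b ≤ 2 * (p * q)) (hb : 0 ≤ b) (hbγ : b * (γ ^ 2 + 4) = 8 * m) (hγ : 4 ≤ γ ^ 2) :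
    N * (Rv * Mv) / q ≤ 2 * m * (Rv + Rl * Mv) ^ 2 * γ ^ 2 := by
  have h1 : p * (N * (Rv * Mv)) ≤ N ^ 2 / 4 * (Rv + Rl * Mv) ^ 2 := by
    have a1 : p * (N * (Rv * Mv)) ≤ (N * Rl) * (N * (Rv * Mv)) :=
      mul_le_mul_of_nonneg_right hpN (by positivity)
    have a2 : 0 ≤ N ^ 2 * (Rv - Rl * Mv) ^ 2 := by positivity
    linarith
  have h2 : N ^ 2 / 4 ≤ p * q * (2 * m * γ ^ 2) := by
    have a1 : N ^ 2 ≤ (4 * m) ^ 2 := pow_le_pow_left₀ hN hNm 2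
    have a3 : b * (γ ^ 2 + 4) ≤ b * (2 * γ ^ 2) := mul_le_mul_of_nonneg_left (by linarith) hb
    have a4 : b * (2 * γ ^ 2) ≤ 2 * (p * q) * (2 * γ ^ 2) :=
      mul_le_mul_of_nonneg_right hbpq (by positivity)
    have a5 : 8 * m * m ≤ 2 * (p * q) * (2 * γ ^ 2) * m :=
      mul_le_mul_of_nonneg_right (by linarith) (by linarith)
    linarith
  have h3 := mul_le_mul_of_nonneg_right h2 (sq_nonneg (Rv + Rl * Mv))
  rw [div_le_iff₀ hq, ← mul_le_mul_iff_right₀ hp]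
  linarith

namespace SepProblem

variable {n m : ℕ} {P : SepProblem n m}

theorem radiusV_ne_top (lam : Fin n → Fin (m + 2) → ℝ) (z : Fin n → Fin (m + 2) → EpiSpace m) :
    radiusV lam z ≠ ⊤ := by
  refine ne_top_of_le_ne_top (b := ∑ i, ∑ j, ‖lam i j • z i j‖ₑ) ?_ ?_
  · simp [ENNReal.sum_eq_top]
  · exact iSup₂_le fun i j => iSup_le fun _ =>
      (Finset.single_le_sum (f := fun j => ‖lam i j • z i j‖ₑ) (fun _ _ => zero_le)
        (Finset.mem_univ j)).trans
      (Finset.single_le_sum (f := fun i => ∑ j, ‖lam i j • z i j‖ₑ) (fun _ _ => zero_le)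
        (Finset.mem_univ i))

theorem radiusLam_ne_top (lam : Fin n → Fin (m + 2) → ℝ) : radiusLam lam ≠ ⊤ := by
  refine ne_top_of_le_ne_top (b := ∑ i, ∑ j, ‖lam i j‖ₑ) ?_ ?_
  · simp [ENNReal.sum_eq_top]
  · exact iSup₂_le fun i j => iSup_le fun _ =>
      (Finset.single_le_sum (f := fun j => ‖lam i j‖ₑ) (fun _ _ => zero_le)
        (Finset.mem_univ j)).trans
      (Finset.single_le_sum (f := fun i => ∑ j, ‖lam i j‖ₑ) (fun _ _ => zero_le)
        (Finset.mem_univ i))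

theorem norm_smul_le_radiusV {lam : Fin n → Fin (m + 2) → ℝ}
    (z : Fin n → Fin (m + 2) → EpiSpace m) {i : Fin n} {j : Fin (m + 2)} (h : lam i j ≠ 1) :
    ‖lam i j • z i j‖ ≤ (radiusV lam z).toReal := by
  have h1 : ‖lam i j • z i j‖ₑ ≤ radiusV lam z :=
    le_iSup₂_of_le (f := fun i j => ⨆ _ : lam i j ≠ 1, ‖lam i j • z i j‖ₑ) i j
      (le_iSup_of_le h le_rfl)
  simpa using ENNReal.toReal_mono (radiusV_ne_top lam z) h1

theorem le_radiusLam {lam : Fin n → Fin (m + 2) → ℝ} {i : Fin n} {j : Fin (m + 2)}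
    (h : lam i j ≠ 1) : lam i j ≤ (radiusLam lam).toReal := by
  have h1 : ‖lam i j‖ₑ ≤ radiusLam lam :=
    le_iSup₂_of_le (f := fun i j => ⨆ _ : lam i j ≠ 1, ‖lam i j‖ₑ) i j (le_iSup_of_le h le_rfl)
  refine (le_abs_self _).trans ?_
  simpa using ENNReal.toReal_mono (radiusLam_ne_top lam) h1

theorem enorm_le_MV {v : Fin n → EpiSpace m} (hv : ∀ i, v i ∈ P.setF i) (i : Fin n) :
    ‖v i‖ₑ ≤ P.MV := by
  have h : ‖∑ k, (EuclideanSpace.single i (1 : ℝ) : Euc n) k • v k‖ₑ ≤ P.MV :=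
    le_iSup₂_of_le (f := fun (a : Euc n) (_ : ‖a‖ ≤ 1) =>
      ⨆ (v : Fin n → EpiSpace m) (_ : ∀ i, v i ∈ P.setF i), ‖∑ i, a i • v i‖ₑ)
      (EuclideanSpace.single i 1) (by simp) (le_iSup₂_of_le v hv le_rfl)
  simpa [PiLp.single_apply, ite_smul] using h

set_option maxHeartbeats 1000000 in
theorem IsOptimalRepresentation.exists_isSparseError {x : P.Var} {w : Euc m}
    {lam : Fin n → Fin (m + 2) → ℝ} {z : Fin n → Fin (m + 2) → EpiSpace m}
    (h : P.IsOptimalRepresentation x w lam z) {γ s : ℝ} (hγ : 0 < γ)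
    (hs : s = n + 1 + 2 * m * (4 / (γ ^ 2 + 4))) :
    ∃ u, P.IsSparseError (P.zStar x w) w s u ∧
      ‖u‖ₑ ≤ ENNReal.ofReal (√(2 * m)) * (radiusV lam z + radiusLam lam * P.MV) *
        ENNReal.ofReal γ := by
  classical
  obtain ⟨-, -, -, hcomb, hz, hnum⟩ := h
  obtain ⟨h0, h1, hcont⟩ := hcomb
  by_cases hle : (numNonzero lam : ℝ) ≤ s
  · exact ⟨0, ⟨lam, z, ⟨h0, h1, hcont⟩, hle, by rw [hz, sub_self]⟩, by simp⟩
  rw [not_le] at hle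
  set b : ℝ := 2 * m * (4 / (γ ^ 2 + 4)) with hb
  have hb0 : 0 ≤ b := by positivity
  have hbm : b < m := by
    have : (numNonzero lam : ℝ) ≤ n + m + 1 := by exact_mod_cast hnum
    linarith
  have hm : (1 : ℝ) ≤ m := by
    have : (0 : ℝ) < m := hb0.trans_lt hbm
    exact_mod_cast this
  have hbeq : b * (γ ^ 2 + 4) = 8 * m := by
    rw [hb]
    field_simp
    ring
  -- For γ² ≤ 4 the allowance `b` is at least m, and the given weights are already sparse enough.
  have hγ4 : 4 < γ ^ 2 := by
    by_contra! hcon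
    have : b * (γ ^ 2 + 4) < m * (γ ^ 2 + 4) := mul_lt_mul_of_pos_right hbm (by positivity)
    nlinarith
  let card : Fin n → ℕ := fun i => (Finset.univ.filter fun j => lam i j ≠ 0).card
  let S : Finset (Fin n) := Finset.univ.filter fun i => ∀ j, lam i j ≠ 1
  have hS : ∀ i ∈ S, ∀ j, lam i j ≠ 1 := fun i hi => (Finset.mem_filter.1 hi).2
  have hcS : ∀ i ∈ S, 2 ≤ card i := fun i hi => two_le_card_support (h1 i) (hS i hi)
  have hcSc : ∀ i ∈ Sᶜ, card i = 1 := fun i hi => card_support_eq_one (h0 i) (h1 i) (by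
    simpa [S] using hi)
  set p := S.card with hp
  set N := ∑ i ∈ S, card i with hN
  have hpc : Sᶜ.card = n - p := by rw [Finset.card_compl, Fintype.card_fin]
  have hpn : p ≤ n := by simpa using Finset.card_le_univ S
  have hsplit : numNonzero lam = N + (n - p) := by
    have : numNonzero lam = ∑ i, card i := rfl
    rw [this, ← Finset.sum_add_sum_compl S, Finset.sum_congr rfl hcSc, Finset.sum_const, hpc]
    simp [hN]
  have hN2 : 2 * p ≤ N := by
    rw [hN, hp, mul_comm, ← smul_eq_mul, ← Finset.sum_const]
    exact Finset.sum_le_sum hcS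
  -- N ≤ m + 1 + p, and N ≥ 2p forces p ≤ m + 1.
  have hNm : N ≤ 2 * (m + 1) := by omega
  have hp0 : 0 < p := by
    rcases Nat.eq_zero_or_pos p with h | h
    · have hS0 : S = ∅ := Finset.card_eq_zero.1 h
      have : numNonzero lam = n := by
        rw [hsplit, hN, hS0, h]
        simp
      rw [this, hs] at hle
      linarith
    · exact h
  set k := ⌊b⌋₊ with hk
  have hkb : (k : ℝ) ≤ b := Nat.floor_le hb0
  have hbk : b < k + 1 := Nat.lt_floor_add_one b
  -- Sampled blocks may use p + k + 1 coefficients in all, since n − p are spent on the others.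
  -- Since q ≥ 1, rounding down loses at most a factor 2.
  set q := (p + k + 1) / p with hqdef
  have hq : 0 < q := Nat.div_pos (by omega) hp0
  have hq1 : p * q ≤ p + k + 1 := Nat.mul_div_le _ _
  have hq2 : p + k + 1 ≤ 2 * (p * q) := by
    have := Nat.lt_mul_div_succ (p + k + 1) hp0
    rw [← hqdef] at this
    nlinarith
  obtain ⟨μ, m0, m1, mS, mSc, merr⟩ := exists_sparse_approximation (z := z) h0 h1 S hq
  have hμnum : numNonzero μ ≤ n + k + 1 := by
    have e : numNonzero μ = ∑ i, (Finset.univ.filter fun j => μ i j ≠ 0).card := rfl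
    have e1 : ∑ i ∈ S, (Finset.univ.filter fun j => μ i j ≠ 0).card ≤ p * q := by
      rw [hp, ← smul_eq_mul, ← Finset.sum_const]
      exact Finset.sum_le_sum mS
    have e2 : ∑ i ∈ Sᶜ, (Finset.univ.filter fun j => μ i j ≠ 0).card = n - p := by
      rw [Finset.sum_congr rfl fun i hi => by rw [mSc i (Finset.mem_compl.1 hi)],
        Finset.sum_congr rfl hcSc, Finset.sum_const, hpc, smul_eq_mul, mul_one]
    rw [e, ← Finset.sum_add_sum_compl S, e2]
    omega
  have hsparse : (numNonzero μ : ℝ) ≤ s := by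
    have : (numNonzero μ : ℝ) ≤ n + k + 1 := by exact_mod_cast hμnum
    linarith
  refine ⟨_, ⟨μ, z, ⟨m0, m1, hcont⟩, hsparse, rfl⟩, ?_⟩
  rw [hz, add_sub_add_right_eq_sub]
  set err := ∑ i, ∑ j, μ i j • z i j - ∑ i, ∑ j, lam i j • z i j with herr
  have hppos : (0 : ℝ) < p := by exact_mod_cast hp0
  have hqpos : (0 : ℝ) < q := by exact_mod_cast hq
  set Rv := (radiusV lam z).toReal with hRv
  set Rl := (radiusLam lam).toReal with hRl
  have hRv0 : 0 ≤ Rv := ENNReal.toReal_nonneg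
  have hsumN : ∀ (g : Fin n → Fin (m + 2) → ℝ) (B : ℝ),
      (∀ i ∈ S, ∀ j, lam i j ≠ 0 → g i j ≤ B) → (∀ i j, lam i j = 0 → g i j = 0) →
      ∑ i ∈ S, ∑ j, g i j ≤ N * B := by
    intro g B hg hg0
    rw [hN, Nat.cast_sum, Finset.sum_mul]
    refine Finset.sum_le_sum fun i hi => ?_
    have e : ∑ j, g i j = ∑ j ∈ Finset.univ.filter fun j => lam i j ≠ 0, g i j := by
      rw [Finset.sum_filter]
      exact Finset.sum_congr rfl fun j _ => by
        by_cases hj : lam i j = 0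
        · simp [hj, hg0]
        · simp [hj]
    rw [e, ← nsmul_eq_mul]
    exact Finset.sum_le_card_nsmul _ _ _ fun j hj => hg i hi j (Finset.mem_filter.1 hj).2
  have hpN : (p : ℝ) ≤ N * Rl := by
    have e : (p : ℝ) = ∑ i ∈ S, ∑ j, lam i j := by simp [h1, hp]
    rw [e]
    exact hsumN lam Rl (fun i hi j _ => le_radiusLam (hS i hi j)) fun _ _ h => h
  have hRl0 : 0 < Rl := by
    by_contra! hcon
    have : (N : ℝ) * Rl ≤ 0 := mul_nonpos_of_nonneg_of_nonpos (Nat.cast_nonneg _) hcon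
    linarith
  have hsq : 0 < √(2 * (m : ℝ)) := Real.sqrt_pos.2 (by linarith)
  -- As `Rl` is positive here, the convention 0·∞ = 0 does not intervene and the right side is
  -- infinite.
  by_cases hMV : P.MV = ⊤
  · have hne : radiusLam lam ≠ 0 := by
      intro h
      rw [hRl, h] at hRl0
      simp at hRl0
    rw [hMV, ENNReal.mul_top hne, add_top, ENNReal.mul_top (by simpa using hsq),
      ENNReal.top_mul (by simpa using hγ)]
    exact le_top
  set Mv := P.MV.toReal with hMvdef
  have hMv0 : 0 ≤ Mv := ENNReal.toReal_nonneg
  have hzMv : ∀ i j, ‖z i j‖ ≤ Mv := fun i j => by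
    have := enorm_le_MV (P := P) (v := fun i => z i j) (fun i => by
      obtain ⟨y, hy1, -, hy3⟩ := hcont i j
      exact ⟨y, hy1, hy3⟩) i
    simpa using ENNReal.toReal_mono hMV this
  have hvar : ∑ i ∈ S, ∑ j, lam i j * ‖z i j‖ ^ 2 ≤ N * (Rv * Mv) := by
    refine hsumN (fun i j => lam i j * ‖z i j‖ ^ 2) _ (fun i hi j _ => ?_) fun i j hij => by
      rw [hij, zero_mul]
    have e := norm_smul_le_radiusV z (hS i hi j)
    rw [norm_smul, Real.norm_of_nonneg (h0 i j)] at e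
    calc lam i j * ‖z i j‖ ^ 2 = (lam i j * ‖z i j‖) * ‖z i j‖ := by ring
      _ ≤ Rv * Mv := mul_le_mul e (hzMv i j) (norm_nonneg _) hRv0
  have hmain : ‖err‖ ≤ √(2 * m) * (Rv + Rl * Mv) * γ := by
    refine (sq_le_sq₀ (norm_nonneg _) (by positivity)).1 ?_
    have hNm' : (N : ℝ) ≤ 4 * m := by
      have : (N : ℝ) ≤ 2 * (m + 1) := by exact_mod_cast hNm
      linarith
    have hq2' : (p : ℝ) + k + 1 ≤ 2 * (p * q) := by exact_mod_cast hq2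
    have hbpq : b ≤ 2 * (p * q) := by linarith
    rw [mul_pow, mul_pow, Real.sq_sqrt (by positivity)]
    exact merr.trans ((div_le_div_of_nonneg_right hvar hqpos.le).trans
      (variance_le hRv0 hMv0 (Nat.cast_nonneg N) hppos hqpos hm hpN hNm' hbpq hb0 hbeq hγ4.le))
  have hfin : ENNReal.ofReal (√(2 * m)) * (radiusV lam z + radiusLam lam * P.MV) *
      ENNReal.ofReal γ = ENNReal.ofReal (√(2 * m) * (Rv + Rl * Mv) * γ) := by
    rw [ENNReal.ofReal_mul (by positivity), ENNReal.ofReal_mul hsq.le,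
      ENNReal.ofReal_add hRv0 (by positivity), ENNReal.ofReal_mul hRl0.le,
      ENNReal.ofReal_toReal (radiusV_ne_top lam z), ENNReal.ofReal_toReal (radiusLam_ne_top lam),
      ENNReal.ofReal_toReal hMV]
  rw [hfin, ← ofReal_norm]
  exact ENNReal.ofReal_le_ofReal hmain

end SepProblem

/-! ### Assembly -/

theorem EpiSpace.max_enorm_le {m : ℕ} (u : EpiSpace m) : max ‖u.fst‖ₑ ‖u.snd‖ₑ ≤ ‖u‖ₑ := by
  have h := WithLp.prod_norm_sq_eq_of_L2 u
  simp only [← ofReal_norm]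
  refine max_le (ENNReal.ofReal_le_ofReal ?_) (ENNReal.ofReal_le_ofReal ?_)
  · exact (sq_le_sq₀ (norm_nonneg _) (norm_nonneg _)).1 (by nlinarith [sq_nonneg ‖u.snd‖])
  · exact (sq_le_sq₀ (norm_nonneg _) (norm_nonneg _)).1 (by nlinarith [sq_nonneg ‖u.fst‖])

theorem mainTheorem7 :
    ∃ c : ℝ, 0 < c ∧
      ∀ (n m : ℕ) (P : SepProblem n m), (∀ i, GoodFunction (P.f i)) → P.hCoP 0 < ⊤ →
        (∃ x w lam z, P.IsOptimalRepresentation x w lam z) ∧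
        ∀ x w lam z, P.IsOptimalRepresentation x w lam z →
          ∀ γ s : ℝ, 0 < γ → s = n + 1 + 2 * m * (c / (γ ^ 2 + c)) →
            (∃ u, P.IsSparseError (P.zStar x w) w s u ∧ P.GapBound s u ∧
              max ‖u.fst‖ₑ ‖u.snd‖ₑ ≤
                ENNReal.ofReal (√(2 * m)) *
                  (SepProblem.radiusV lam z + SepProblem.radiusLam lam * P.MV) *
                  ENNReal.ofReal γ) ∧
            ∀ u, P.IsSparseError (P.zStar x w) w s u →
              (∀ u', P.IsSparseError (P.zStar x w) w s u' → ‖u‖ ≤ ‖u'‖) →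
              P.GapBound s u ∧
              max ‖u.fst‖ₑ ‖u.snd‖ₑ ≤
                ENNReal.ofReal (√(2 * m)) *
                  (SepProblem.radiusV lam z + SepProblem.radiusLam lam * P.MV) *
                  ENNReal.ofReal γ := by
  refine ⟨4, by norm_num, fun n m P hf hP =>
    ⟨SepProblem.exists_isOptimalRepresentation hf hP, fun x w lam z hrep γ s hγ hs => ?_⟩⟩
  obtain ⟨u, hu, hnorm⟩ := hrep.exists_isSparseError hγ hs
  refine ⟨⟨u, hu, hu.gapBound hf hrep.1, (EpiSpace.max_enorm_le u).trans hnorm⟩,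
    fun u' hu' hmin => ⟨hu'.gapBound hf hrep.1, (EpiSpace.max_enorm_le u').trans ?_⟩⟩
  -- A minimal error is no longer than the constructed one.
  exact (enorm_le_iff_norm_le.2 (hmin u hu)).trans hnorm
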